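/- Let $\Lambda$ be the ring of symmetric functions, i.e. the subring of the ring of formal power series over $\mathbb{Z}$ in countably many variables $\xi_1,\xi_2,\dots$ generated by the elementary symmetric functions $e_i$, $i\ge 0$ (with $e_0=1$), and let $h_i\in\Lambda$ be the complete homogeneous symmetric functions (the sum of all monomials of degree $i$). For a partition $\pi=(\pi_1\ge\pi_2\ge\cdots)$ let $s_\pi$ be the Schur function, $s_\pi=\sum_T\prod_c\xi_{T(c)}$, the sum being over the semistandard Young tableaux $T$ of shape $\pi$ and the product over the cells $c$ of $\pi$. For $n\ge 0$ let $I_{e,n}$ (resp. $I_{h,n}$) be the ideal of $\Lambda$ generated by the $e_i$ (resp. the $h_i$) with $i\ge n$, and let $\Lambda_n=\Lambda/I_{e,n+1}$. Then every $s_\pi$ lies in $\Lambda$, and: (a) for every $n\ge 0$, the $s_\pi$ for partitions $\pi$ with at least $n$ rows form a $\mathbb{Z}$-basis of the ideal $I_{e,n}$; (b) for every $n\ge 0$, $\Lambda_n$ is the polynomial ring over $\mathbb{Z}$ in the classes of $e_1,\dots,e_n$, and the classes of the $s_\pi$ for partitions $\pi$ with at most $n$ rows form a $\mathbb{Z}$-basis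 of $\Lambda_n$; (c) for every $n\ge 0$, the $s_\pi$ for partitions $\pi$ with $\pi_1\ge n$ form a $\mathbb{Z}$-basis of the ideal $I_{h,n}$ (where $\pi_1=0$ for the empty partition); (d) for all $m,n\ge 1$, the $s_\pi$ for partitions $\pi$ whose Young diagram contains that of the hook $(m,1^{n-1})$ form a $\mathbb{Z}$-basis of the ideal $I_{h,m}\cap I_{e,n}$. -/

import Mathlib

namespace SymmetricFunctions

/-- The elementary symmetric function `e_i` in the variables `ξ_0, ξ_1, ξ_2, …`: the sum of all
squarefree monomials of degree `i`, as a formal power series. -/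
noncomputable def e (i : ℕ) : MvPowerSeries ℕ ℤ :=
  open Classical in fun d => if d.degree = i ∧ ∀ k, d k ≤ 1 then 1 else 0

/-- The complete homogeneous symmetric function `h_i`: the sum of all monomials of degree `i`. -/
noncomputable def h (i : ℕ) : MvPowerSeries ℕ ℤ :=
  fun d => if d.degree = i then 1 else 0

/-- The ring `Λ` of symmetric functions: the subring of the ring of formal power series in
`ξ_0, ξ_1, ξ_2, …` that is generated by the elementary symmetric functions. -/
noncomputable def Lam : Subring (MvPowerSeries ℕ ℤ) :=
  Subring.closure (Set.range e)

theorem e_mem (i : ℕ) : e i ∈ Lam := Subring.subset_closure ⟨i, rfl⟩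

theorem coeff_e (i : ℕ) (d : ℕ →₀ ℕ) [Decidable (d.degree = i ∧ ∀ k, d k ≤ 1)] :
    MvPowerSeries.coeff d (e i) = if d.degree = i ∧ ∀ k, d k ≤ 1 then 1 else 0 := by
  change e i d = _
  unfold e
  congr

theorem coeff_h (i : ℕ) (d : ℕ →₀ ℕ) :
    MvPowerSeries.coeff d (h i) = if d.degree = i then 1 else 0 := rfl

theorem e_zero : e 0 = 1 := by
  classical
  ext d
  rw [coeff_e, MvPowerSeries.coeff_one]
  by_cases hd : d = 0
  · simp [hd]
  · simp [hd, Finsupp.degree_eq_zero_iff]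

theorem h_zero : h 0 = 1 := by
  classical
  ext d
  rw [coeff_h, MvPowerSeries.coeff_one]
  simp [Finsupp.degree_eq_zero_iff]

/-- The degree `n` part of `E(-t) H(t) = 1`. -/
theorem sum_e_mul_h (n : ℕ) (hn : n ≠ 0) :
    ∑ p ∈ Finset.HasAntidiagonal.antidiagonal n, (-1 : MvPowerSeries ℕ ℤ) ^ p.1 * e p.1 * h p.2 = 0 := by
  classical
  ext d
  have key : ∀ p : ℕ × ℕ, MvPowerSeries.coeff d ((-1 : MvPowerSeries ℕ ℤ) ^ p.1 * e p.1 * h p.2)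
      = ∑ q ∈ Finset.HasAntidiagonal.antidiagonal d,
        if q.1.degree = p.1 ∧ q.2.degree = p.2 ∧ ∀ k, q.1 k ≤ 1 then (-1 : ℤ) ^ p.1 else 0 := by
    intro p
    have h1 : (-1 : MvPowerSeries ℕ ℤ) ^ p.1 * e p.1 * h p.2
        = ((-1 : ℤ) ^ p.1) • (e p.1 * h p.2) := by
      rw [zsmul_eq_mul]
      push_cast
      ring
    rw [h1, map_zsmul, MvPowerSeries.coeff_mul, smul_eq_mul, Finset.mul_sum]
    refine Finset.sum_congr rfl fun q _ => ?_
    rw [coeff_e, coeff_h]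
    split_ifs <;> simp_all
  rw [map_sum, Finset.sum_congr rfl fun p _ => key p, Finset.sum_comm, map_zero]
  by_cases hd : d.degree = n
  · have hd0 : d ≠ 0 := by
      rintro rfl
      exact hn (by simpa using hd.symm)
    obtain ⟨k, hk⟩ : ∃ k, d k ≠ 0 := by
      by_contra! hc
      exact hd0 (Finsupp.ext hc)
    have inner : ∀ q ∈ Finset.HasAntidiagonal.antidiagonal d, (∑ p ∈ Finset.HasAntidiagonal.antidiagonal n,
        if q.1.degree = p.1 ∧ q.2.degree = p.2 ∧ ∀ k, q.1 k ≤ 1 then (-1 : ℤ) ^ p.1 else 0)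
        = if ∀ k, q.1 k ≤ 1 then (-1 : ℤ) ^ q.1.degree else 0 := by
      intro q hq
      rw [Finset.HasAntidiagonal.mem_antidiagonal] at hq
      rw [Finset.sum_eq_single (q.1.degree, q.2.degree)]
      · simp
      · rintro ⟨a, b⟩ _ hne
        rw [if_neg]
        rintro ⟨rfl, rfl, _⟩
        exact hne rfl
      · intro hne
        exfalso
        apply hne
        rw [Finset.HasAntidiagonal.mem_antidiagonal, ← hd, ← hq]
        simp
    rw [Finset.sum_congr rfl inner, ← Finset.sum_filter]
    refine Finset.sum_involution (fun q _ => if q.1 k = 0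
      then (q.1 + Finsupp.single k 1, q.2 - Finsupp.single k 1)
      else (q.1 - Finsupp.single k 1, q.2 + Finsupp.single k 1)) ?_ ?_ ?_ ?_
    · rintro ⟨x, y⟩ hq
      by_cases hx : x k = 0
      · simp [hx, pow_succ]
      · have hle : Finsupp.single k 1 ≤ x := by
          rw [Finsupp.single_le_iff]; omega
        have : x = (x - Finsupp.single k 1) + Finsupp.single k 1 :=
          (tsub_add_cancel_of_le hle).symm
        simp only [hx, if_false]
        conv_lhs => enter [1]; rw [this]
        simp [pow_succ]
    · rintro ⟨x, y⟩ hq _ heq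
      by_cases hx : x k = 0
      · have := congrArg (fun q : (ℕ →₀ ℕ) × (ℕ →₀ ℕ) => q.1 k) heq
        simp [hx] at this
      · have := congrArg (fun q : (ℕ →₀ ℕ) × (ℕ →₀ ℕ) => q.2 k) heq
        simp [hx] at this
    · rintro ⟨x, y⟩ hq
      simp only [Finset.mem_filter, Finset.HasAntidiagonal.mem_antidiagonal] at hq ⊢
      obtain ⟨hxy, hx1⟩ := hq
      have hc : ∀ j, x j + y j = d j := fun j => by rw [← hxy]; rfl
      by_cases hx : x k = 0
      · simp only [hx, if_true]
        refine ⟨?_, ?_⟩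
        · ext j
          have := hc j
          by_cases hj : k = j
          · subst hj
            simp
            omega
          · simp [hj]
            omega
        · intro j
          have := hx1 j
          by_cases hj : k = j
          · subst hj
            simp [hx]
          · simpa [Finsupp.single_apply, hj] using this
      · simp only [hx, if_false]
        refine ⟨?_, ?_⟩
        · ext j
          have := hc j
          by_cases hj : k = j
          · subst hj
            simp
            omega
          · simp [hj]
            omega
        · intro j
          have := hx1 j
          simp only [Finsupp.tsub_apply]
          omega
    · rintro ⟨x, y⟩ hq
      simp only [Finset.mem_filter, Finset.HasAntidiagonal.mem_antidiagonal] at hq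
      obtain ⟨hxy, hx1⟩ := hq
      have hc : ∀ j, x j + y j = d j := fun j => by rw [← hxy]; rfl
      have hk1 := hx1 k
      have hck := hc k
      by_cases hx : x k = 0
      · have hle : Finsupp.single k 1 ≤ y := by
          rw [Finsupp.single_le_iff]; omega
        simp [hx, tsub_add_cancel_of_le hle]
      · have hle : Finsupp.single k 1 ≤ x := by
          rw [Finsupp.single_le_iff]; omega
        have hx' : x k - 1 = 0 := by omega
        simp [hx, hx', tsub_add_cancel_of_le hle]
  · refine Finset.sum_eq_zero fun q hq => Finset.sum_eq_zero fun p hp => ?_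
    rw [Finset.HasAntidiagonal.mem_antidiagonal] at hq hp
    rw [if_neg]
    rintro ⟨h1, h2, _⟩
    apply hd
    rw [← hq, ← hp, ← h1, ← h2]
    simp

theorem h_mem (n : ℕ) : h n ∈ Lam := by
  induction n using Nat.strong_induction_on with
  | _ n ih =>
    rcases Nat.eq_zero_or_pos n with rfl | hn
    · rw [h_zero]
      exact Lam.one_mem
    · obtain ⟨m, rfl⟩ : ∃ m, n = m + 1 := ⟨n - 1, by omega⟩
      have hs := sum_e_mul_h (m + 1) (by omega)
      rw [Finset.Nat.antidiagonal_succ, Finset.sum_cons] at hs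
      simp only [pow_zero, one_mul, e_zero] at hs
      rw [eq_neg_of_add_eq_zero_left hs]
      refine Lam.neg_mem (Lam.sum_mem fun p hp => ?_)
      obtain ⟨q, hq, rfl⟩ := Finset.mem_map.mp hp
      rw [Finset.HasAntidiagonal.mem_antidiagonal] at hq
      refine Lam.mul_mem (Lam.mul_mem (Lam.pow_mem (Lam.neg_mem Lam.one_mem) _) (e_mem _)) ?_
      exact ih _ (by simp; omega)

/-- The content of a semistandard tableau `T`: the exponent of the monomial `∏ ξ_{T(c)}`, the
product being over the cells `c` of the tableau. -/
noncomputable def content {π : YoungDiagram} (T : SemistandardYoungTableau π) : ℕ →₀ ℕ :=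
  ∑ c ∈ π.cells, Finsupp.single (T c.1 c.2) 1

theorem finite_content {π : YoungDiagram} (d : ℕ →₀ ℕ) :
    Finite {T : SemistandardYoungTableau π // content T = d} := by
  classical
  have hmem : ∀ T : {T : SemistandardYoungTableau π // content T = d}, ∀ c : π.cells,
      T.1 c.1.1 c.1.2 ∈ d.support := by
    rintro ⟨T, hT⟩ ⟨c, hc⟩
    subst hT
    change T c.1 c.2 ∈ Finsupp.support (∑ c ∈ π.cells, Finsupp.single (T c.1 c.2) 1)
    rw [Finsupp.mem_support_iff, Finsupp.finsetSum_apply]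
    refine (Nat.pos_of_ne_zero ?_).ne'
    intro h0
    have := (Finset.sum_eq_zero_iff.mp h0) c hc
    simp at this
  refine Finite.of_injective
    (fun T => fun c : π.cells => (⟨T.1 c.1.1 c.1.2, hmem T c⟩ : d.support)) ?_
  rintro ⟨T, hT⟩ ⟨T', hT'⟩ heq
  refine Subtype.ext (SemistandardYoungTableau.ext fun i j => ?_)
  by_cases hij : (i, j) ∈ π
  · have := congrFun heq ⟨(i, j), hij⟩
    simpa using this
  · rw [T.zeros hij, T'.zeros hij]

/-- The Schur function `s_π = ∑_T ∏_c ξ_{T(c)}`, the sum being over all semistandard tableaux `T`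
of shape `π`: the coefficient of a monomial is the (finite) number of semistandard tableaux of
shape `π` with that content. -/
noncomputable def schur (π : YoungDiagram) : MvPowerSeries ℕ ℤ :=
  fun d => (Nat.card {T : SemistandardYoungTableau π // content T = d} : ℤ)

/-- The ideal `I_{e,n}` of `Λ` generated by the `e_i` with `i ≥ n`. -/
noncomputable def Ie (n : ℕ) : Ideal Lam :=
  Ideal.span {x | ∃ i, n ≤ i ∧ x = ⟨e i, e_mem i⟩}

/-- The ideal `I_{h,n}` of `Λ` generated by the `h_i` with `i ≥ n`. -/
noncomputable def Ih (n : ℕ) : Ideal Lam :=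
  Ideal.span {x | ∃ i, n ≤ i ∧ x = ⟨h i, h_mem i⟩}

/-- The ring `Λ_n = Λ / I_{e,n+1}`, in which `e_i` becomes zero for all `i > n`. -/
abbrev LamN (n : ℕ) : Type := Lam ⧸ Ie (n + 1)

/-- The Young diagram of the hook `(m, 1^{n-1})`, for `m, n ≥ 1`: a first row of `m` cells and a
first column of `n` cells. -/
def hook (m n : ℕ) : YoungDiagram where
  cells := ({0} ×ˢ Finset.range m) ∪ (Finset.range n ×ˢ {0})
  isLowerSet := by
    rintro ⟨a, b⟩ ⟨c, d⟩ ⟨h1, h2⟩ hab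
    simp only [Finset.coe_union, Finset.coe_product, Set.mem_union, Set.mem_prod,
      Finset.mem_coe, Finset.mem_singleton, Finset.mem_range] at hab ⊢
    simp only at h1 h2
    omega

end SymmetricFunctions

open SymmetricFunctions

/-! Everything rests on the two Pieri rules `h_mul_schur` and `e_mul_schur`: multiplying `s_l` by
`h_i` (resp. `e_i`) gives the sum of the `s_κ` for which `κ / l` is a horizontal (resp. vertical)
strip of size `i`.

The rule for `h` is proved by induction on the number of variables. Splitting off the last variable
turns both sides into sums over pairs of strips (`trunc_succ_h`, `trunc_succ_schur`), and a local
rule on row lengths matches the two index sets. The rule for `e` follows from it: by a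
sign-reversing involution, the sums over vertical strips satisfy the recursion that `∑ (-1)^p e_p
h_(n-p) = 0` imposes on `e_n s_l`.

Pieri products contain only larger diagrams, and `Λ` is generated by the `e_i`, so the span of the
`s_π` with `π` in an upper set of diagrams is an ideal (`mul_mem_span_schurLam`). For the upper set
"at least `n` rows" this ideal contains the generators of `I_{e,n}`. Conversely, removing the first
column of `π` writes `s_π` as a multiple of `e_k`, with `k` the number of rows, minus Schur
functions of the same degree with more rows; downward induction puts `s_π` in `I_{e,n}`. First rows
and the `h_i` are treated alike.

As the Schur functions are linearly independent (`linearIndependent_schur`), they form a basis of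
`Λ`, and the ideals, their intersections and the quotients are described by subsets of this basis.
That `Λ_n` is a polynomial ring comes from setting all but `n` variables to zero and applying the
fundamental theorem on symmetric polynomials. -/

namespace SymmetricFunctions

open Finset

/-! ### Young diagrams in terms of their row lengths; strips. -/

section Diagrams

theorem le_iff_rowLen {μ l : YoungDiagram} : μ ≤ l ↔ ∀ i, μ.rowLen i ≤ l.rowLen i := by
  constructor
  · intro hle i
    by_contra! hlt
    have h1 : (i, l.rowLen i) ∈ μ := YoungDiagram.mem_iff_lt_rowLen.2 hlt
    have h2 : (i, l.rowLen i) ∈ l := hle h1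
    exact lt_irrefl _ (YoungDiagram.mem_iff_lt_rowLen.1 h2)
  · rintro hle ⟨i, j⟩ hij
    exact YoungDiagram.mem_iff_lt_rowLen.2
      ((YoungDiagram.mem_iff_lt_rowLen.1 hij).trans_le (hle i))

theorem ext_rowLen {μ l : YoungDiagram} (hr : ∀ i, μ.rowLen i = l.rowLen i) : μ = l :=
  le_antisymm (le_iff_rowLen.2 fun i => (hr i).le) (le_iff_rowLen.2 fun i => (hr i).ge)

theorem card_mono {μ l : YoungDiagram} (hle : μ ≤ l) : μ.card ≤ l.card :=
  card_le_card (YoungDiagram.cells_subset_iff.2 hle)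

theorem eq_of_le_of_card_le {μ l : YoungDiagram} (hle : μ ≤ l) (hc : l.card ≤ μ.card) :
    μ = l :=
  YoungDiagram.ext (eq_of_subset_of_card_le (YoungDiagram.cells_subset_iff.2 hle) hc)

theorem rowLen_eq_zero_iff {l : YoungDiagram} {i : ℕ} : l.rowLen i = 0 ↔ l.colLen 0 ≤ i := by
  rw [← not_iff_not, ← ne_eq, ← Nat.pos_iff_ne_zero, ← YoungDiagram.mem_iff_lt_rowLen,
    YoungDiagram.mem_iff_lt_colLen, not_le]

theorem card_eq_sum_rowLen {l : YoungDiagram} {M : ℕ} (hM : l.rowLen M = 0) :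
    l.card = ∑ i ∈ range M, l.rowLen i := by
  have hmap : ∀ c ∈ l.cells, c.1 ∈ range M := by
    rintro ⟨i, j⟩ hc
    rw [YoungDiagram.mem_cells, YoungDiagram.mem_iff_lt_rowLen] at hc
    by_contra hi
    have := l.rowLen_anti M i (by simpa using hi)
    omega
  rw [YoungDiagram.card, card_eq_sum_card_fiberwise hmap]
  exact sum_congr rfl fun i _ => (YoungDiagram.rowLen_eq_card l).symm

theorem colLen_le_card (l : YoungDiagram) (j : ℕ) : l.colLen j ≤ l.card := by
  rw [YoungDiagram.colLen_eq_card]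
  exact card_le_card (filter_subset _ _)

theorem rowLen_le_card (l : YoungDiagram) (i : ℕ) : l.rowLen i ≤ l.card := by
  rw [YoungDiagram.rowLen_eq_card]
  exact card_le_card (filter_subset _ _)

theorem rowLen_card (l : YoungDiagram) : l.rowLen l.card = 0 :=
  rowLen_eq_zero_iff.2 (colLen_le_card l 0)

theorem rowLen_of_card_le (l : YoungDiagram) {M : ℕ} (hM : l.card ≤ M) : l.rowLen M = 0 :=
  rowLen_eq_zero_iff.2 ((colLen_le_card l 0).trans hM)

theorem finite_card_le (M : ℕ) : {l : YoungDiagram | l.card ≤ M}.Finite := by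
  refine Set.Finite.of_finite_image (f := YoungDiagram.cells)
    ((range M ×ˢ range M).powerset.finite_toSet.subset ?_) fun _ _ _ _ hc => YoungDiagram.ext hc
  rintro _ ⟨l, hl, rfl⟩
  rw [mem_coe, mem_powerset]
  rintro ⟨i, j⟩ hc
  rw [YoungDiagram.mem_cells] at hc
  have h1 := YoungDiagram.mem_iff_lt_rowLen.1 hc
  have h2 := YoungDiagram.mem_iff_lt_colLen.1 hc
  have h3 := rowLen_le_card l i
  have h4 := colLen_le_card l j
  have hl' : l.card ≤ M := hl
  rw [mem_product, mem_range, mem_range]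
  constructor <;> simp only <;> omega

/-- The Young diagrams with at most `M` cells. -/
noncomputable def diagrams (M : ℕ) : Finset YoungDiagram := (finite_card_le M).toFinset

theorem mem_diagrams {M : ℕ} {l : YoungDiagram} : l ∈ diagrams M ↔ l.card ≤ M := by
  simp [diagrams]

open Classical in
/-- The Young diagram with row lengths `f`, or `⊥` if there is none. -/
noncomputable def ofRows (f : ℕ → ℕ) : YoungDiagram :=
  if hf : Antitone f ∧ ∃ M, f M = 0 then
    { cells := (range (Nat.find hf.2) ×ˢ range (f 0)).filter fun c => c.2 < f c.1
      isLowerSet := by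
        rintro ⟨a, b⟩ ⟨c, d⟩ ⟨h1, h2⟩ hab
        simp only at h1 h2
        simp only [coe_filter, mem_product, mem_range, Set.mem_ofPred_eq] at hab ⊢
        have := hf.1 h1
        refine ⟨⟨?_, ?_⟩, ?_⟩ <;> omega }
  else ⊥

theorem rowLen_ofRows {f : ℕ → ℕ} (hf : Antitone f) {M : ℕ} (hM : f M = 0) (i : ℕ) :
    (ofRows f).rowLen i = f i := by
  classical
  have hf' : Antitone f ∧ ∃ M, f M = 0 := ⟨hf, M, hM⟩
  have key : ∀ j, (i, j) ∈ ofRows f ↔ j < f i := by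
    intro j
    rw [ofRows, dif_pos hf', ← YoungDiagram.mem_cells]
    simp only [mem_filter, mem_product, mem_range, and_iff_right_iff_imp]
    intro hj
    refine ⟨?_, hj.trans_le (hf (Nat.zero_le i))⟩
    by_contra! hi
    have := hf hi
    have := Nat.find_spec hf'.2
    omega
  apply le_antisymm
  · by_contra! hlt
    exact lt_irrefl _ ((key _).1 (YoungDiagram.mem_iff_lt_rowLen.2 hlt))
  · by_contra! hlt
    exact lt_irrefl _ (YoungDiagram.mem_iff_lt_rowLen.1 ((key _).2 hlt))

theorem card_bot : (⊥ : YoungDiagram).card = 0 := by simp [YoungDiagram.card]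

theorem rowLen_bot (i : ℕ) : (⊥ : YoungDiagram).rowLen i = 0 := by
  have := rowLen_le_card ⊥ i
  rw [card_bot] at this
  omega

/-- `μ ⊆ l` and `l / μ` is a horizontal strip. -/
def HorizontalStrip (μ l : YoungDiagram) : Prop :=
  ∀ i, l.rowLen (i + 1) ≤ μ.rowLen i ∧ μ.rowLen i ≤ l.rowLen i

/-- `μ ⊆ l` and `l / μ` is a vertical strip. -/
def VerticalStrip (μ l : YoungDiagram) : Prop :=
  ∀ i, μ.rowLen i ≤ l.rowLen i ∧ l.rowLen i ≤ μ.rowLen i + 1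

theorem HorizontalStrip.le {μ l : YoungDiagram} (hs : HorizontalStrip μ l) : μ ≤ l :=
  le_iff_rowLen.2 fun i => (hs i).2

theorem VerticalStrip.le {μ l : YoungDiagram} (hs : VerticalStrip μ l) : μ ≤ l :=
  le_iff_rowLen.2 fun i => (hs i).1

end Diagrams

/-! ### Setting all but finitely many variables to zero. -/

section Truncation

/-- The exponent `d` involves only variables `ξ_j` with `j < N`. -/
def VarsBelow (N : ℕ) (d : ℕ →₀ ℕ) : Prop := ∀ j, N ≤ j → d j = 0

theorem varsBelow_zero (N : ℕ) : VarsBelow N 0 := fun _ _ => rfl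

theorem varsBelow_add {N : ℕ} {c d : ℕ →₀ ℕ} :
    VarsBelow N (c + d) ↔ VarsBelow N c ∧ VarsBelow N d := by
  refine ⟨fun hcd => ⟨fun j hj => ?_, fun j hj => ?_⟩, fun hcd j hj => ?_⟩
  · have := hcd j hj
    simp only [Finsupp.add_apply] at this
    omega
  · have := hcd j hj
    simp only [Finsupp.add_apply] at this
    omega
  · simp [hcd.1 j hj, hcd.2 j hj]

open Classical in
/-- The power series obtained by setting the variables `ξ_j` with `j ≥ N` to zero. -/
noncomputable def truncFun (N : ℕ) (f : MvPowerSeries ℕ ℤ) : MvPowerSeries ℕ ℤ :=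
  fun d => if VarsBelow N d then MvPowerSeries.coeff d f else 0

open Classical in
theorem coeff_truncFun (N : ℕ) (f : MvPowerSeries ℕ ℤ) (d : ℕ →₀ ℕ) :
    MvPowerSeries.coeff d (truncFun N f) =
      if VarsBelow N d then MvPowerSeries.coeff d f else 0 := rfl

/-- The endomorphism of the ring of power series that sets the variables `ξ_j` with `j ≥ N` to
zero. -/
noncomputable def trunc (N : ℕ) : MvPowerSeries ℕ ℤ →+* MvPowerSeries ℕ ℤ where
  toFun := truncFun N
  map_one' := by
    classical
    ext d
    rw [coeff_truncFun, MvPowerSeries.coeff_one]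
    by_cases hd : d = 0
    · subst hd
      rw [if_pos (varsBelow_zero N)]
    · simp [hd]
  map_zero' := by
    ext d
    simp [coeff_truncFun]
  map_add' f g := by
    ext d
    simp only [map_add, coeff_truncFun]
    split_ifs <;> simp
  map_mul' f g := by
    classical
    ext d
    simp only [MvPowerSeries.coeff_mul, coeff_truncFun]
    have hp : ∀ p ∈ HasAntidiagonal.antidiagonal d,
        VarsBelow N d ↔ VarsBelow N p.1 ∧ VarsBelow N p.2 := by
      intro p hp
      rw [← HasAntidiagonal.mem_antidiagonal.1 hp, varsBelow_add]
    by_cases hd : VarsBelow N d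
    · rw [if_pos hd]
      refine sum_congr rfl fun p hpd => ?_
      have := (hp p hpd).1 hd
      rw [if_pos this.1, if_pos this.2]
    · rw [if_neg hd]
      symm
      refine sum_eq_zero fun p hpd => ?_
      have := mt (hp p hpd).2 hd
      split_ifs <;> simp_all

open Classical in
theorem coeff_trunc (N : ℕ) (f : MvPowerSeries ℕ ℤ) (d : ℕ →₀ ℕ) :
    MvPowerSeries.coeff d (trunc N f) =
      if VarsBelow N d then MvPowerSeries.coeff d f else 0 := rfl

/-- An exponent has finite support, so its coefficient survives in some truncation. -/
theorem eq_of_trunc_eq {f g : MvPowerSeries ℕ ℤ} (hfg : ∀ N, trunc N f = trunc N g) :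
    f = g := by
  ext d
  obtain ⟨N, hN⟩ : ∃ N, VarsBelow N d := by
    refine ⟨d.support.sup id + 1, fun j hj => ?_⟩
    by_contra hne
    have := le_sup (f := id) (Finsupp.mem_support_iff.2 hne)
    simp only [id] at this
    omega
  have := congrArg (MvPowerSeries.coeff d) (hfg N)
  rwa [coeff_trunc, coeff_trunc, if_pos hN, if_pos hN] at this

-- Since `trunc N f` is free of `ξ_N`, the factor `X N ^ k` must account for the whole exponent of
-- `ξ_N`.
open Classical in
theorem coeff_X_pow_mul_trunc (N k : ℕ) (f : MvPowerSeries ℕ ℤ) (d : ℕ →₀ ℕ) :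
    MvPowerSeries.coeff d (MvPowerSeries.X N ^ k * trunc N f) =
      if VarsBelow (N + 1) d ∧ d N = k then MvPowerSeries.coeff (d.erase N) f else 0 := by
  rw [MvPowerSeries.X_pow_eq, MvPowerSeries.coeff_monomial_mul, one_mul, coeff_trunc]
  simp only [Finsupp.single_le_iff]
  by_cases hk : d N = k
  · have he : d - Finsupp.single N k = d.erase N := by
      ext j
      by_cases hj : j = N
      · subst hj; simp [hk]
      · simp [hj]
    rw [if_pos hk.ge, he]
    refine if_congr ⟨fun hd => ⟨fun j hj => ?_, hk⟩, fun hd j hj => ?_⟩ rfl rfl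
    · have := hd j (by omega)
      rwa [Finsupp.erase_ne (by omega)] at this
    · by_cases hjN : j = N
      · simp [hjN]
      · rw [Finsupp.erase_ne hjN]
        exact hd.1 j (by omega)
  · rw [if_neg (fun hd => hk hd.2) (c := _ ∧ _)]
    split_ifs with h1 h2
    · have := h2 N le_rfl
      simp at this
      omega
    · rfl
    · rfl

theorem degree_erase_add (d : ℕ →₀ ℕ) (N : ℕ) : (d.erase N).degree + d N = d.degree := by
  conv_rhs => rw [← Finsupp.erase_add_single N d]
  simp

/-- Monomials are sorted by their exponent `k` in the last variable `ξ_N`. -/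
theorem trunc_succ_h (N i : ℕ) : trunc (N + 1) (h i) =
    ∑ k ∈ range (i + 1), MvPowerSeries.X N ^ k * trunc N (h (i - k)) := by
  classical
  ext d
  rw [coeff_trunc, map_sum, sum_congr rfl fun k _ => coeff_X_pow_mul_trunc N k _ d]
  by_cases hd : VarsBelow (N + 1) d
  · have hdeg := degree_erase_add d N
    simp only [coeff_h, hd, true_and, if_true]
    rw [sum_ite_eq]
    simp only [mem_range]
    split_ifs <;> first | rfl | omega
  · simp [hd]

end Truncation

/-! ### The branching rule: removing the largest entry from tableaux. -/

section Branching

variable {l : YoungDiagram}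

theorem content_apply {π : YoungDiagram} (T : SemistandardYoungTableau π) (k : ℕ) :
    content T k = #{c ∈ π.cells | T c.1 c.2 = k} := by
  rw [content, Finsupp.finsetSum_apply, card_filter]
  exact sum_congr rfl fun c _ => by rw [Finsupp.single_apply]

theorem entry_lt_of_content {π : YoungDiagram} (T : SemistandardYoungTableau π) {N : ℕ}
    (hT : VarsBelow N (content T)) {i j : ℕ} (hij : (i, j) ∈ π) : T i j < N := by
  by_contra! hN
  have := hT _ hN
  rw [content_apply, card_eq_zero, filter_eq_empty_iff] at this
  exact this (x := (i, j)) hij rfl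

/-- The diagram of the cells of a tableau with entry `< N`. -/
def subShape (T : SemistandardYoungTableau l) (N : ℕ) : YoungDiagram where
  cells := {c ∈ l.cells | T c.1 c.2 < N}
  isLowerSet := by
    rintro ⟨a, b⟩ ⟨c, d⟩ ⟨h1, h2⟩ hab
    simp only at h1 h2
    simp only [coe_filter, YoungDiagram.mem_cells, Set.mem_ofPred_eq] at hab ⊢
    refine ⟨l.up_left_mem h1 h2 hab.1, lt_of_le_of_lt ?_ hab.2⟩
    exact (T.row_weak_of_le h2 (l.up_left_mem h1 le_rfl hab.1)).trans (T.col_weak h1 hab.1)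

theorem mem_subShape {T : SemistandardYoungTableau l} {N : ℕ} {c : ℕ × ℕ} :
    c ∈ subShape T N ↔ c ∈ l ∧ T c.1 c.2 < N := by
  rw [← YoungDiagram.mem_cells, subShape, mem_filter, YoungDiagram.mem_cells]

/-- Columns are strict, so a cell directly above a cell of `l` has entry less than `N`: the entries
`N` occur at most once per column. -/
theorem horizontalStrip_subShape (T : SemistandardYoungTableau l) {N : ℕ}
    (hT : ∀ i j, (i, j) ∈ l → T i j < N + 1) : HorizontalStrip (subShape T N) l := by
  refine fun i => ⟨?_, ?_⟩
  · by_contra! hlt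
    have h1 := YoungDiagram.mem_iff_lt_rowLen.2 hlt
    have h2 : (i, (subShape T N).rowLen i) ∈ subShape T N := by
      refine mem_subShape.2 ⟨l.up_left_mem (Nat.le_succ i) le_rfl h1, ?_⟩
      have := T.col_strict (Nat.lt_add_one i) h1
      have := hT _ _ h1
      simp only
      omega
    exact lt_irrefl _ (YoungDiagram.mem_iff_lt_rowLen.1 h2)
  · exact le_iff_rowLen.1 (fun c hc => (mem_subShape.1 hc).1) i

/-- The restriction of a tableau to a smaller diagram. -/
def restrict {μ : YoungDiagram} (T : SemistandardYoungTableau l) (hμ : μ ≤ l) :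
    SemistandardYoungTableau μ where
  entry i j := if (i, j) ∈ μ then T i j else 0
  row_weak' {i j1 j2} hj hm := by
    rw [if_pos hm, if_pos (μ.up_left_mem le_rfl hj.le hm)]
    exact T.row_weak hj (hμ hm)
  col_strict' {i1 i2 j} hi hm := by
    rw [if_pos hm, if_pos (μ.up_left_mem hi.le le_rfl hm)]
    exact T.col_strict hi (hμ hm)
  zeros' hm := if_neg hm

theorem restrict_apply {μ : YoungDiagram} (T : SemistandardYoungTableau l) (hμ : μ ≤ l)
    (i j : ℕ) : restrict T hμ i j = if (i, j) ∈ μ then T i j else 0 := rfl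

/-- The extension of a tableau with entries `< N` by a horizontal strip of entries `N`. -/
def extend {μ : YoungDiagram} (T : SemistandardYoungTableau μ) (hμ : HorizontalStrip μ l)
    (N : ℕ) (hT : ∀ i j, (i, j) ∈ μ → T i j < N) : SemistandardYoungTableau l where
  entry i j := if (i, j) ∈ μ then T i j else if (i, j) ∈ l then N else 0
  row_weak' {i j1 j2} hj hm := by
    by_cases h2 : (i, j2) ∈ μ
    · rw [if_pos h2, if_pos (μ.up_left_mem le_rfl hj.le h2)]
      exact T.row_weak hj h2
    · rw [if_neg h2, if_pos hm]
      split_ifs with h1 h3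
      · exact (hT _ _ h1).le
      · exact le_rfl
      · exact Nat.zero_le N
  col_strict' {i1 i2 j} hi hm := by
    -- The strip condition gives `l_{i2} ≤ l_{i1+1} ≤ μ_{i1}`, so every cell of `l` lying over a
    -- lower one belongs to `μ`.
    have h1 : (i1, j) ∈ μ := by
      rw [YoungDiagram.mem_iff_lt_rowLen] at hm ⊢
      have := l.rowLen_anti (i1 + 1) i2 hi
      have := (hμ i1).1
      omega
    rw [if_pos h1]
    by_cases h2 : (i2, j) ∈ μ
    · rw [if_pos h2]
      exact T.col_strict hi h2
    · rw [if_neg h2, if_pos hm]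
      exact hT _ _ h1
  zeros' {i j} hm := by
    rw [if_neg (fun hc => hm (hμ.le hc)), if_neg hm]

theorem extend_apply {μ : YoungDiagram} (T : SemistandardYoungTableau μ)
    (hμ : HorizontalStrip μ l) (N : ℕ) (hT : ∀ i j, (i, j) ∈ μ → T i j < N) (i j : ℕ) :
    extend T hμ N hT i j = if (i, j) ∈ μ then T i j else if (i, j) ∈ l then N else 0 := rfl

theorem subShape_extend {μ : YoungDiagram} (T : SemistandardYoungTableau μ)
    (hμ : HorizontalStrip μ l) (N : ℕ) (hT : ∀ i j, (i, j) ∈ μ → T i j < N) :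
    subShape (extend T hμ N hT) N = μ := by
  refine SetLike.ext fun c => ?_
  rw [mem_subShape, extend_apply]
  split_ifs with h1 h2
  · simp [h1, hT _ _ h1, hμ.le h1]
  · simp [h1]
  · exact iff_of_false (fun hc => h2 hc.1) h1

theorem content_eq_add_single {μ : YoungDiagram} (T : SemistandardYoungTableau l)
    (T' : SemistandardYoungTableau μ) (hμ : μ ≤ l) {N : ℕ}
    (h1 : ∀ i j, (i, j) ∈ μ → T i j = T' i j)
    (h2 : ∀ i j, (i, j) ∈ l → (i, j) ∉ μ → T i j = N) :
    content T = content T' + Finsupp.single N (l.card - μ.card) := by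
  have hsub : μ.cells ⊆ l.cells := YoungDiagram.cells_subset_iff.2 hμ
  have hd : ∑ c ∈ l.cells \ μ.cells, Finsupp.single (T c.1 c.2) 1
      = Finsupp.single N (l.card - μ.card) := by
    have hc : ∀ c ∈ l.cells \ μ.cells, Finsupp.single (T c.1 c.2) 1 = Finsupp.single N 1 := by
      intro c hc
      rw [mem_sdiff] at hc
      rw [h2 c.1 c.2 hc.1 hc.2]
    rw [sum_congr rfl hc, sum_const, card_sdiff_of_subset hsub, Finsupp.smul_single, smul_eq_mul,
      mul_one]
  rw [content, ← sum_sdiff hsub, hd, add_comm, content]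
  congr 1
  exact sum_congr rfl fun c hc => by rw [h1 c.1 c.2 hc]

theorem erase_eq_of_add_single {a d : ℕ →₀ ℕ} {N k : ℕ} (ha : a N = 0)
    (hd : d = a + Finsupp.single N k) : a = d.erase N ∧ k = d N := by
  subst hd
  refine ⟨?_, by simp [ha]⟩
  ext j
  by_cases hj : j = N
  · subst hj; simp [ha]
  · simp [hj]

/-- Deleting the entries `N` and filling the strip `l / μ` with `N` are mutually inverse. -/
theorem card_subShape_eq {μ : YoungDiagram} (hμ : HorizontalStrip μ l) {N : ℕ} {d : ℕ →₀ ℕ}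
    (hd : VarsBelow (N + 1) d) (hk : d N = l.card - μ.card) :
    Nat.card {T : SemistandardYoungTableau l // content T = d ∧ subShape T N = μ} =
      Nat.card {T : SemistandardYoungTableau μ // content T = d.erase N} := by
  have hlt : ∀ T : SemistandardYoungTableau μ, content T = d.erase N →
      ∀ i j, (i, j) ∈ μ → T i j < N := by
    intro T hT i j hij
    refine entry_lt_of_content T (fun k hk => ?_) hij
    rw [hT]
    by_cases hkN : k = N
    · simp [hkN]
    · rw [Finsupp.erase_ne hkN]
      exact hd k (by omega)
  have hN : ∀ T : SemistandardYoungTableau l, content T = d → ∀ i j, (i, j) ∈ l →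
      (i, j) ∉ subShape T N → T i j = N := by
    intro T hT i j hij hn
    have h1 := entry_lt_of_content T (N := N + 1) (by rw [hT]; exact hd) hij
    have h2 : ¬ T i j < N := fun hc => hn (mem_subShape.2 ⟨hij, hc⟩)
    omega
  refine Nat.card_congr
    { toFun := fun T => ⟨restrict T.1 hμ.le, ?_⟩
      invFun := fun T => ⟨extend T.1 hμ N (hlt T.1 T.2), ?_, subShape_extend _ _ _ _⟩
      left_inv := ?_
      right_inv := ?_ }
  · obtain ⟨T, hT, rfl⟩ := T
    have hadd := content_eq_add_single T (restrict T hμ.le) hμ.le (N := N)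
      (fun i j hij => by rw [restrict_apply, if_pos hij]) (hN T hT)
    rw [hT] at hadd
    refine (erase_eq_of_add_single ?_ hadd).1
    rw [content_apply, card_eq_zero, filter_eq_empty_iff]
    rintro ⟨i, j⟩ hij
    rw [restrict_apply, if_pos ((YoungDiagram.mem_cells _).1 hij)]
    exact (mem_subShape.1 hij).2.ne
  · have hadd := content_eq_add_single (extend T.1 hμ N (hlt T.1 T.2)) T.1 hμ.le (N := N)
      (fun i j hij => by rw [extend_apply, if_pos hij])
      (fun i j hij hn => by rw [extend_apply, if_neg hn, if_pos hij])
    rw [hadd, T.2, ← hk, Finsupp.erase_add_single]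
  · rintro ⟨T, hT, rfl⟩
    refine Subtype.ext (SemistandardYoungTableau.ext fun i j => ?_)
    rw [extend_apply, restrict_apply]
    split_ifs with h1 h2
    · rfl
    · exact (hN T hT i j h2 h1).symm
    · exact (T.zeros h2).symm
  · rintro ⟨T, hT⟩
    refine Subtype.ext (SemistandardYoungTableau.ext fun i j => ?_)
    rw [restrict_apply, extend_apply]
    split_ifs with h1
    · rfl
    · exact (T.zeros h1).symm

theorem card_of_subShape_eq {μ : YoungDiagram} {N : ℕ} {d : ℕ →₀ ℕ}
    (hd : VarsBelow (N + 1) d) (T : SemistandardYoungTableau l) (hT : content T = d)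
    (hs : subShape T N = μ) : HorizontalStrip μ l ∧ d N = l.card - μ.card := by
  have hlt : ∀ i j, (i, j) ∈ l → T i j < N + 1 := fun i j hij =>
    entry_lt_of_content T (by rw [hT]; exact hd) hij
  have hμ := horizontalStrip_subShape T hlt
  subst hs
  refine ⟨hμ, ?_⟩
  have hadd := content_eq_add_single T (restrict T hμ.le) hμ.le (N := N)
    (fun i j hij => by rw [restrict_apply, if_pos hij]) fun i j hij hn => by
      have h2 : ¬ T i j < N := fun hc => hn (mem_subShape.2 ⟨hij, hc⟩)
      have := hlt i j hij
      omega
  rw [hT] at hadd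
  refine (erase_eq_of_add_single ?_ hadd).2.symm
  rw [content_apply, card_eq_zero, filter_eq_empty_iff]
  rintro ⟨i, j⟩ hij
  rw [restrict_apply, if_pos ((YoungDiagram.mem_cells _).1 hij)]
  exact (mem_subShape.1 hij).2.ne

theorem coeff_schur (π : YoungDiagram) (d : ℕ →₀ ℕ) : MvPowerSeries.coeff d (schur π) =
    (Nat.card {T : SemistandardYoungTableau π // content T = d} : ℤ) := rfl

-- Tableaux are sorted by the diagram `μ` of their entries below `N`; the remaining `l.card -
-- μ.card` cells all carry `N`. The bound `M` only makes the index set finite.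
open Classical in
theorem trunc_succ_schur (N M : ℕ) (hM : l.card ≤ M) : trunc (N + 1) (schur l) =
    ∑ μ ∈ diagrams M with HorizontalStrip μ l,
      MvPowerSeries.X N ^ (l.card - μ.card) * trunc N (schur μ) := by
  ext d
  rw [coeff_trunc, map_sum, sum_congr rfl fun k _ => coeff_X_pow_mul_trunc N _ _ d]
  by_cases hd : VarsBelow (N + 1) d
  · simp only [coeff_schur, hd, true_and, if_true]
    have : Finite {T : SemistandardYoungTableau l // content T = d} := finite_content d
    have := Fintype.ofFinite {T : SemistandardYoungTableau l // content T = d}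
    have hmap : ∀ T ∈ (univ : Finset {T : SemistandardYoungTableau l // content T = d}),
        subShape T.1 N ∈ {μ ∈ diagrams M | HorizontalStrip μ l} := by
      rintro ⟨T, hT⟩ -
      have hs := (card_of_subShape_eq hd T hT rfl).1
      rw [mem_filter, mem_diagrams]
      exact ⟨(card_mono hs.le).trans hM, hs⟩
    rw [Nat.card_eq_fintype_card, ← Finset.card_univ, card_eq_sum_card_fiberwise hmap, Nat.cast_sum]
    refine sum_congr rfl fun μ hμ => ?_
    have hfib : #{T : {T : SemistandardYoungTableau l // content T = d} | subShape T.1 N = μ} =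
        Nat.card {T : SemistandardYoungTableau l // content T = d ∧ subShape T N = μ} := by
      rw [← Fintype.card_subtype, ← Nat.card_eq_fintype_card]
      exact Nat.card_congr (Equiv.subtypeSubtypeEquivSubtypeInter _ fun T => subShape T N = μ)
    rw [hfib]
    split_ifs with hk
    · rw [card_subShape_eq (mem_filter.1 hμ).2 hd hk]
    · rw [Nat.cast_eq_zero]
      have : IsEmpty {T : SemistandardYoungTableau l // content T = d ∧ subShape T N = μ} :=
        ⟨fun T => hk (card_of_subShape_eq hd T.1 T.2.1 T.2.2).2⟩
      exact Nat.card_of_isEmpty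
  · simp [hd]

end Branching

/-! ### Homogeneity of Schur functions and the empty diagram. -/

section Schur

theorem degree_content {π : YoungDiagram} (T : SemistandardYoungTableau π) :
    (content T).degree = π.card := by
  rw [content, map_sum]
  simp [YoungDiagram.card]

theorem coeff_schur_of_degree_ne {π : YoungDiagram} {d : ℕ →₀ ℕ} (hd : d.degree ≠ π.card) :
    MvPowerSeries.coeff d (schur π) = 0 := by
  rw [coeff_schur, Nat.cast_eq_zero]
  have : IsEmpty {T : SemistandardYoungTableau π // content T = d} :=
    ⟨fun T => hd (by rw [← T.2, degree_content])⟩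
  exact Nat.card_of_isEmpty

theorem card_eq_zero_iff {π : YoungDiagram} : π.card = 0 ↔ π = ⊥ := by
  refine ⟨fun hc => ?_, fun hc => hc ▸ card_bot⟩
  exact (eq_of_le_of_card_le bot_le (by omega)).symm

theorem schur_bot : schur ⊥ = 1 := by
  classical
  ext d
  rw [MvPowerSeries.coeff_one]
  split_ifs with hd
  · have hT : ∀ T : SemistandardYoungTableau ⊥, content T = d := fun T => by
      rw [hd, ← Finsupp.degree_eq_zero_iff, degree_content, card_bot]
    rw [coeff_schur, Nat.cast_eq_one, Nat.card_eq_one_iff_unique]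
    refine ⟨⟨fun T T' => Subtype.ext (SemistandardYoungTableau.ext fun i j => ?_)⟩,
      ⟨⟨default, hT _⟩⟩⟩
    rw [T.1.zeros (YoungDiagram.notMem_bot _), T'.1.zeros (YoungDiagram.notMem_bot _)]
  · rw [coeff_schur_of_degree_ne]
    rwa [card_bot, Ne, Finsupp.degree_eq_zero_iff]

theorem coeff_zero_schur {π : YoungDiagram} [Decidable (π = ⊥)] :
    MvPowerSeries.coeff 0 (schur π) = if π = ⊥ then 1 else 0 := by
  split_ifs with hπ
  · rw [hπ, schur_bot]
    simp
  · rw [coeff_schur_of_degree_ne]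
    rw [map_zero]
    exact fun hc => hπ (card_eq_zero_iff.1 hc.symm)

end Schur

/-! ### The local rule: a bijection `(μ, k) ↔ κ` for fixed `l` and `ν`. -/

section LocalRule

variable {l ν μ κ : YoungDiagram} {k : ℕ}

/-- The row lengths of the diagram `up l ν μ k`. -/
def upRow (l ν μ : YoungDiagram) (k : ℕ) : ℕ → ℕ
  | 0 => max (l.rowLen 0) (ν.rowLen 0) + k
  | j + 1 =>
    min (l.rowLen j) (ν.rowLen j) + max (l.rowLen (j + 1)) (ν.rowLen (j + 1)) - μ.rowLen j

/-- The diagram `κ ⊇ l, ν` that the local rule assigns to `μ ⊆ l, ν` and `k`. -/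
noncomputable def up (l ν μ : YoungDiagram) (k : ℕ) : YoungDiagram :=
  ofRows (upRow l ν μ k)

/-- The diagram `μ ⊆ l, ν` that the local rule assigns to `κ ⊇ l, ν`. -/
noncomputable def down (l ν κ : YoungDiagram) : YoungDiagram :=
  ofRows fun j =>
    min (l.rowLen j) (ν.rowLen j) + max (l.rowLen (j + 1)) (ν.rowLen (j + 1)) - κ.rowLen (j + 1)

/-- The strip conditions say `max(l_{j+1}, ν_{j+1}) ≤ μ_j ≤ min(l_j, ν_j)`. Hence the subtraction is
exact and the new row `j + 1` lies between the same two bounds, which makes the rows decrease. -/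
theorem rowLen_up (h1 : HorizontalStrip μ l) (h2 : HorizontalStrip μ ν) :
    (up l ν μ k).rowLen 0 = max (l.rowLen 0) (ν.rowLen 0) + k ∧
    ∀ j, (up l ν μ k).rowLen (j + 1) =
      min (l.rowLen j) (ν.rowLen j) + max (l.rowLen (j + 1)) (ν.rowLen (j + 1)) - μ.rowLen j := by
  have hf : Antitone (upRow l ν μ k) := by
    refine antitone_nat_of_succ_le fun j => ?_
    cases j with
    | zero =>
      simp only [upRow]
      have := h1 0
      have := h2 0
      omega
    | succ j =>
      simp only [upRow]
      have := h1 j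
      have := h2 j
      have := h1 (j + 1)
      have := h2 (j + 1)
      omega
  have h0 := rowLen_ofRows hf (M := l.card + ν.card + 1) (by
    have h3 := rowLen_of_card_le l (M := l.card + ν.card) (by omega)
    have h4 := rowLen_of_card_le l (M := l.card + ν.card + 1) (by omega)
    have h5 := rowLen_of_card_le ν (M := l.card + ν.card + 1) (by omega)
    simp only [upRow, h3, h4, h5]
    simp)
  exact ⟨h0 0, fun j => h0 (j + 1)⟩

theorem rowLen_down (h1 : HorizontalStrip l κ) (h2 : HorizontalStrip ν κ) (j : ℕ) :
    (down l ν κ).rowLen j = min (l.rowLen j) (ν.rowLen j) +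
      max (l.rowLen (j + 1)) (ν.rowLen (j + 1)) - κ.rowLen (j + 1) := by
  refine rowLen_ofRows (antitone_nat_of_succ_le fun j => ?_) (M := l.card + ν.card) ?_ j
  · have := h1 j
    have := h2 j
    have := h1 (j + 1)
    have := h2 (j + 1)
    have := h1 (j + 1 + 1)
    have := h2 (j + 1 + 1)
    omega
  · have h3 := rowLen_of_card_le l (M := l.card + ν.card) (by omega)
    have h4 := rowLen_of_card_le l (M := l.card + ν.card + 1) (by omega)
    have h5 := rowLen_of_card_le ν (M := l.card + ν.card + 1) (by omega)
    simp only [h3, h4, h5]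
    simp

/-- Sum over all rows and use `min + max = l_j + ν_j`; row `0` of `κ`, which has no partner in `μ`,
contributes the extra `k`. -/
theorem card_add_card (h0 : κ.rowLen 0 = max (l.rowLen 0) (ν.rowLen 0) + k)
    (hs : ∀ j, μ.rowLen j + κ.rowLen (j + 1) =
      min (l.rowLen j) (ν.rowLen j) + max (l.rowLen (j + 1)) (ν.rowLen (j + 1))) :
    κ.card + μ.card = l.card + ν.card + k := by
  set M := κ.card + μ.card + l.card + ν.card with hM
  rw [card_eq_sum_rowLen (rowLen_of_card_le κ (M := M + 1) (by omega)),
    card_eq_sum_rowLen (rowLen_of_card_le μ (M := M) (by omega)),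
    card_eq_sum_rowLen (rowLen_of_card_le l (M := M + 1) (by omega)),
    card_eq_sum_rowLen (rowLen_of_card_le ν (M := M + 1) (by omega)), sum_range_succ', h0]
  have h1 : ∑ j ∈ range (M + 1), l.rowLen j + ∑ j ∈ range (M + 1), ν.rowLen j =
      ∑ j ∈ range (M + 1), min (l.rowLen j) (ν.rowLen j) +
        ∑ j ∈ range (M + 1), max (l.rowLen j) (ν.rowLen j) := by
    rw [← sum_add_distrib, ← sum_add_distrib]
    exact sum_congr rfl fun j _ => (min_add_max _ _).symm
  have h2 : ∑ j ∈ range M, κ.rowLen (j + 1) + ∑ j ∈ range M, μ.rowLen j =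
      ∑ j ∈ range M, min (l.rowLen j) (ν.rowLen j) +
        ∑ j ∈ range M, max (l.rowLen (j + 1)) (ν.rowLen (j + 1)) := by
    rw [← sum_add_distrib, ← sum_add_distrib]
    exact sum_congr rfl fun j _ => by rw [← hs, add_comm]
  have h3 : min (l.rowLen M) (ν.rowLen M) = 0 := by
    rw [rowLen_of_card_le l (by omega), Nat.zero_min]
  rw [h1, sum_range_succ, h3, sum_range_succ' (fun j => max (l.rowLen j) (ν.rowLen j))]
  omega

theorem horizontalStrip_up (h1 : HorizontalStrip μ l) (h2 : HorizontalStrip μ ν) :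
    HorizontalStrip l (up l ν μ k) ∧ HorizontalStrip ν (up l ν μ k) := by
  obtain ⟨h3, h4⟩ := rowLen_up (k := k) h1 h2
  constructor
  all_goals
    intro j
    rw [h4]
    have := h1 j
    have := h2 j
    cases j with
    | zero => rw [h3]; omega
    | succ j =>
      rw [h4]
      have := h1 j
      have := h2 j
      omega

theorem horizontalStrip_down (h1 : HorizontalStrip l κ) (h2 : HorizontalStrip ν κ) :
    HorizontalStrip (down l ν κ) l ∧ HorizontalStrip (down l ν κ) ν := by
  constructor
  all_goals
    intro j
    rw [rowLen_down h1 h2]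
    have := h1 j
    have := h2 j
    have := h1 (j + 1)
    have := h2 (j + 1)
    omega

theorem card_up (h1 : HorizontalStrip μ l) (h2 : HorizontalStrip μ ν) :
    (up l ν μ k).card + μ.card = l.card + ν.card + k := by
  obtain ⟨h3, h4⟩ := rowLen_up (k := k) h1 h2
  refine card_add_card h3 fun j => ?_
  rw [h4]
  have := h1 j
  have := h2 j
  omega

theorem card_down (h1 : HorizontalStrip l κ) (h2 : HorizontalStrip ν κ) :
    κ.card + (down l ν κ).card =
      l.card + ν.card + (κ.rowLen 0 - max (l.rowLen 0) (ν.rowLen 0)) := by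
  refine card_add_card ?_ fun j => ?_
  · have := h1 0
    have := h2 0
    omega
  · rw [rowLen_down h1 h2]
    have := h1 j
    have := h2 j
    have := h1 (j + 1)
    have := h2 (j + 1)
    omega

/-- For given `l` and `ν` the rule prescribes `μ_j + κ_{j+1}`, so `μ` and the rows of `κ` after the
first determine each other; row `0` of `κ` records `k`. -/
theorem down_up (h1 : HorizontalStrip μ l) (h2 : HorizontalStrip μ ν) :
    down l ν (up l ν μ k) = μ := by
  obtain ⟨h3, h4⟩ := rowLen_up (k := k) h1 h2
  obtain ⟨h5, h6⟩ := horizontalStrip_up (k := k) h1 h2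
  refine ext_rowLen fun j => ?_
  rw [rowLen_down h5 h6, h4]
  have := h1 j
  have := h2 j
  omega

theorem up_down (h1 : HorizontalStrip l κ) (h2 : HorizontalStrip ν κ) :
    up l ν (down l ν κ) (κ.rowLen 0 - max (l.rowLen 0) (ν.rowLen 0)) = κ := by
  obtain ⟨h3, h4⟩ := horizontalStrip_down h1 h2
  obtain ⟨h5, h6⟩ := rowLen_up (k := κ.rowLen 0 - max (l.rowLen 0) (ν.rowLen 0)) h3 h4
  refine ext_rowLen fun j => ?_
  cases j with
  | zero =>
    rw [h5]
    have := h1 0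
    have := h2 0
    omega
  | succ j =>
    rw [h6, rowLen_down h1 h2]
    have := h1 j
    have := h2 j
    have := h1 (j + 1)
    have := h2 (j + 1)
    omega

end LocalRule

/-! ### Pieri's rule for the complete homogeneous functions. -/

section Pieri

theorem trunc_zero_eq (f : MvPowerSeries ℕ ℤ) :
    trunc 0 f = MvPowerSeries.C (MvPowerSeries.constantCoeff f) := by
  classical
  ext d
  rw [coeff_trunc, MvPowerSeries.coeff_C]
  have : VarsBelow 0 d ↔ d = 0 :=
    ⟨fun hd => Finsupp.ext fun j => hd j (Nat.zero_le j), fun hd => hd ▸ varsBelow_zero 0⟩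
  simp only [this]
  split_ifs with hd
  · rw [hd, MvPowerSeries.coeff_zero_eq_constantCoeff_apply]
  · rfl

open Classical in
theorem constantCoeff_h (i : ℕ) :
    MvPowerSeries.constantCoeff (h i) = if i = 0 then 1 else 0 := by
  rw [← MvPowerSeries.coeff_zero_eq_constantCoeff_apply, coeff_h]
  simp [eq_comm]

-- Induction on the number of variables makes Pieri's rule a bijection between chains `l ⊇ μ ⊆ ν`
-- with a number `k`, and chains `l ⊆ κ ⊇ ν`. This is the local rule.
open Classical in
theorem trunc_h_mul_schur (N : ℕ) : ∀ (l : YoungDiagram) (i M : ℕ), l.card + i ≤ M →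
    trunc N (h i * schur l) =
      ∑ κ ∈ diagrams M with HorizontalStrip l κ ∧ κ.card = l.card + i, trunc N (schur κ) := by
  induction N with
  | zero =>
    intro l i M hM
    simp only [trunc_zero_eq]
    rw [← map_sum, map_mul, constantCoeff_h]
    congr 1
    simp only [← MvPowerSeries.coeff_zero_eq_constantCoeff_apply, coeff_zero_schur]
    rw [sum_ite_eq']
    simp only [mem_filter, mem_diagrams, card_bot]
    by_cases hl : l = ⊥
    · subst hl
      simp [card_bot, HorizontalStrip, rowLen_bot, eq_comm]
    · have := mt card_eq_zero_iff.1 hl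
      rw [if_neg hl, mul_zero, if_neg]
      omega
  | succ N ih =>
    intro l i M hM
    -- The exponent of `ξ_N` is rewritten in terms of `ν` alone, so that it can be compared with the
    -- right side, where it is `κ.card - ν.card`.
    have hL : ∀ k ∈ range (i + 1), ∀ μ ∈ {μ ∈ diagrams M | HorizontalStrip μ l},
        MvPowerSeries.X N ^ k * trunc N (h (i - k)) *
          (MvPowerSeries.X N ^ (l.card - μ.card) * trunc N (schur μ)) =
        ∑ ν ∈ diagrams M with HorizontalStrip μ ν ∧ ν.card = μ.card + (i - k),
          MvPowerSeries.X N ^ (l.card + i - ν.card) * trunc N (schur ν) := by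
      intro k hk μ hμ
      rw [mem_range] at hk
      have hμl := card_mono (mem_filter.1 hμ).2.le
      rw [mul_mul_mul_comm, ← map_mul, ih μ (i - k) M (by omega), ← pow_add, mul_sum]
      refine sum_congr rfl fun ν hν => ?_
      have := (mem_filter.1 hν).2.2
      congr 2
      omega
    rw [map_mul, trunc_succ_h, trunc_succ_schur N M (by omega), sum_mul_sum,
      sum_congr rfl fun k hk => sum_congr rfl (hL k hk),
      sum_congr rfl fun κ hκ => trunc_succ_schur N M (mem_diagrams.1 (mem_filter.1 hκ).1)]
    simp only [sum_sigma']
    -- The diagram `ν` is kept fixed, and `(k, μ)` is exchanged for `κ`.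
    refine sum_bij' (fun a _ => ⟨up l a.2.2 a.2.1 a.1, a.2.2⟩)
      (fun b _ => ⟨b.1.rowLen 0 - max (l.rowLen 0) (b.2.rowLen 0), down l b.2 b.1, b.2⟩)
      ?_ ?_ ?_ ?_ ?_
    · rintro ⟨k, μ, ν⟩ ha
      simp only [mem_sigma, mem_range, mem_filter, mem_diagrams] at ha ⊢
      obtain ⟨hk, ⟨hμM, h1⟩, hνM, h2, hc⟩ := ha
      have h3 := horizontalStrip_up (k := k) h1 h2
      have h4 := card_up (k := k) h1 h2
      refine ⟨⟨?_, h3.1, ?_⟩, hνM, h3.2⟩ <;> omega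
    · rintro ⟨κ, ν⟩ hb
      simp only [mem_sigma, mem_range, mem_filter, mem_diagrams] at hb ⊢
      obtain ⟨⟨hκM, h1, hc⟩, hνM, h2⟩ := hb
      have h3 := horizontalStrip_down h1 h2
      have h4 := card_down h1 h2
      have h5 := card_mono h3.1.le
      have h6 := card_mono h3.2.le
      have h7 := card_mono h2.le
      refine ⟨?_, ⟨?_, h3.1⟩, hνM, h3.2, ?_⟩ <;> omega
    · rintro ⟨k, μ, ν⟩ ha
      simp only [mem_sigma, mem_filter] at ha
      obtain ⟨-, ⟨-, h1⟩, -, h2, -⟩ := ha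
      rw [down_up h1 h2, (rowLen_up (k := k) h1 h2).1, Nat.add_sub_cancel_left]
    · rintro ⟨κ, ν⟩ hb
      simp only [mem_sigma, mem_filter] at hb
      obtain ⟨⟨-, h1, -⟩, -, h2⟩ := hb
      rw [up_down h1 h2]
    · rintro ⟨k, μ, ν⟩ ha
      simp only [mem_sigma, mem_range, mem_filter, mem_diagrams] at ha ⊢
      obtain ⟨hk, ⟨hμM, h1⟩, hνM, h2, hc⟩ := ha
      have h4 := card_up (k := k) h1 h2
      congr 2
      omega

open Classical in
/-- **Pieri's rule** for complete homogeneous symmetric functions. -/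
theorem h_mul_schur (l : YoungDiagram) (i : ℕ) {M : ℕ} (hM : l.card + i ≤ M) :
    h i * schur l =
      ∑ κ ∈ diagrams M with HorizontalStrip l κ ∧ κ.card = l.card + i, schur κ :=
  eq_of_trunc_eq fun N => by rw [trunc_h_mul_schur N l i M hM, map_sum]

end Pieri

/-! ### Pieri's rule for the elementary functions, by a sign-reversing involution. -/

section DualPieri

variable {l μ κ : YoungDiagram}

/-- The diagram obtained from `μ` by switching row `i` between the lengths `l_i` and `l_i + 1`. -/
noncomputable def toggle (l : YoungDiagram) (i : ℕ) (μ : YoungDiagram) : YoungDiagram :=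
  ofRows fun j => if j = i then 2 * l.rowLen i + 1 - μ.rowLen i else μ.rowLen j

/-- The modified rows still lie between `κ_{j+1}` and `κ_j`, hence decrease. In row `i` the lower
bound is `κ_{i+1} ≤ l_{i+1} ≤ l_i`, which is where `hmax` enters. -/
theorem rowLen_toggle {i : ℕ} (hi : l.rowLen i < κ.rowLen i)
    (hmax : ∀ j, i < j → κ.rowLen j ≤ l.rowLen j) (h1 : VerticalStrip l μ)
    (h2 : HorizontalStrip μ κ) (j : ℕ) :
    (toggle l i μ).rowLen j =
      if j = i then 2 * l.rowLen i + 1 - μ.rowLen i else μ.rowLen j := by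
  have hb : ∀ j, κ.rowLen (j + 1) ≤
      (if j = i then 2 * l.rowLen i + 1 - μ.rowLen i else μ.rowLen j) ∧
      (if j = i then 2 * l.rowLen i + 1 - μ.rowLen i else μ.rowLen j) ≤ κ.rowLen j := by
    intro j
    have := h2 j
    split_ifs with hj
    · subst hj
      have := h1 j
      have := hmax (j + 1) (by omega)
      have := l.rowLen_anti j (j + 1) (by omega)
      omega
    · exact this
  refine rowLen_ofRows (antitone_nat_of_succ_le fun j => ?_) (M := κ.card) ?_ j
  · exact (hb (j + 1)).2.trans (hb j).1
  · have := (hb κ.card).2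
    rw [rowLen_card] at this
    omega

theorem toggle_strips {i : ℕ} (hi : l.rowLen i < κ.rowLen i)
    (hmax : ∀ j, i < j → κ.rowLen j ≤ l.rowLen j) (h1 : VerticalStrip l μ)
    (h2 : HorizontalStrip μ κ) :
    VerticalStrip l (toggle l i μ) ∧ HorizontalStrip (toggle l i μ) κ := by
  constructor
  all_goals
    intro j
    rw [rowLen_toggle hi hmax h1 h2]
    have := h1 j
    have := h2 j
    split_ifs with hj
    · subst hj
      have := hmax (j + 1) (by omega)
      have := l.rowLen_anti j (j + 1) (by omega)
      omega
    · assumption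

/-- As `μ_i` is `l_i` or `l_i + 1`, toggling changes the size by exactly one and so reverses the
sign. -/
theorem card_toggle {i : ℕ} (hi : l.rowLen i < κ.rowLen i)
    (hmax : ∀ j, i < j → κ.rowLen j ≤ l.rowLen j) (h1 : VerticalStrip l μ)
    (h2 : HorizontalStrip μ κ) :
    (toggle l i μ).card + 2 * μ.rowLen i = μ.card + 2 * l.rowLen i + 1 := by
  set M := μ.card + (toggle l i μ).card + i + 1
  have hiM : i ∈ range M := by rw [mem_range]; omega
  rw [card_eq_sum_rowLen (rowLen_of_card_le μ (M := M) (by omega)),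
    card_eq_sum_rowLen (rowLen_of_card_le (toggle l i μ) (M := M) (by omega)),
    ← add_sum_erase _ _ hiM, ← add_sum_erase _ (fun j => μ.rowLen j) hiM]
  have hs : ∑ j ∈ (range M).erase i, (toggle l i μ).rowLen j =
      ∑ j ∈ (range M).erase i, μ.rowLen j := by
    refine sum_congr rfl fun j hj => ?_
    rw [rowLen_toggle hi hmax h1 h2, if_neg (ne_of_mem_erase hj)]
  rw [hs, rowLen_toggle hi hmax h1 h2, if_pos rfl]
  have := h1 i
  omega

-- Intermediate diagrams cancel in pairs by toggling the last row in which `κ` is longer than `l`.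
open Classical in
theorem sum_sign_eq_zero (hne : l ≠ κ) {M : ℕ} (hM : κ.card ≤ M) :
    ∑ μ ∈ diagrams M with VerticalStrip l μ ∧ HorizontalStrip μ κ, (-1 : ℤ) ^ μ.card = 0 := by
  by_cases hle : l ≤ κ
  swap
  · rw [filter_eq_empty_iff.2 fun μ _ hμ => hle (hμ.1.le.trans hμ.2.le), sum_empty]
  obtain ⟨j, hj⟩ : ∃ j, l.rowLen j < κ.rowLen j := by
    by_contra! hc
    exact hne (le_antisymm hle (le_iff_rowLen.2 hc))
  have hbd : ∀ j, l.rowLen j < κ.rowLen j → j ≤ κ.card := by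
    intro j hj
    by_contra! hc
    rw [rowLen_of_card_le κ hc.le] at hj
    omega
  set i := Nat.findGreatest (fun j => l.rowLen j < κ.rowLen j) κ.card
  have hi : l.rowLen i < κ.rowLen i :=
    Nat.findGreatest_spec (P := fun j => l.rowLen j < κ.rowLen j) (hbd j hj) hj
  have hmax : ∀ j, i < j → κ.rowLen j ≤ l.rowLen j := by
    intro j hij
    by_contra! hc
    exact Nat.findGreatest_is_greatest hij (hbd j hc) hc
  refine sum_involution (fun μ _ => toggle l i μ) ?_ ?_ ?_ ?_
  · intro μ hμ
    obtain ⟨h1, h2⟩ := (mem_filter.1 hμ).2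
    have hc := card_toggle hi hmax h1 h2
    have h3 : (-1 : ℤ) ^ (toggle l i μ).card = (-1) ^ (μ.card + 1) := by
      calc (-1 : ℤ) ^ (toggle l i μ).card
          = (-1) ^ ((toggle l i μ).card + 2 * μ.rowLen i) := by simp [pow_add, pow_mul]
        _ = (-1) ^ (μ.card + 1) := by rw [hc]; simp [pow_add, pow_mul]
    rw [h3, pow_succ]
    ring
  · intro μ hμ _ heq
    obtain ⟨h1, h2⟩ := (mem_filter.1 hμ).2
    have hc := card_toggle hi hmax h1 h2
    rw [heq] at hc
    omega
  · intro μ hμ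
    obtain ⟨h1, h2⟩ := (mem_filter.1 hμ).2
    have h3 := toggle_strips hi hmax h1 h2
    exact mem_filter.2 ⟨mem_diagrams.2 ((card_mono h3.2.le).trans hM), h3⟩
  · intro μ hμ
    obtain ⟨h1, h2⟩ := (mem_filter.1 hμ).2
    obtain ⟨h3, h4⟩ := toggle_strips hi hmax h1 h2
    refine ext_rowLen fun j => ?_
    rw [rowLen_toggle hi hmax h3 h4, rowLen_toggle hi hmax h1 h2 i, rowLen_toggle hi hmax h1 h2 j,
      if_pos (rfl : i = i)]
    have := h1 i
    split_ifs with hj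
    · rw [hj]
      omega
    · rfl

-- The vertical-strip sums, which are to be `e_p s_l`, satisfy the recursion of `sum_e_mul_h`. After
-- applying Pieri's rule for `h` and collecting by the final diagram `κ`, every coefficient vanishes
-- by `sum_sign_eq_zero`; `κ ≠ l` because `n ≠ 0`.
open Classical in
theorem sum_vertical_mul_h (l : YoungDiagram) {n M : ℕ} (hn : n ≠ 0) (hM : l.card + n ≤ M) :
    ∑ p ∈ HasAntidiagonal.antidiagonal n, (-1 : MvPowerSeries ℕ ℤ) ^ p.1 *
      (∑ μ ∈ diagrams M with VerticalStrip l μ ∧ μ.card = l.card + p.1, schur μ) * h p.2 = 0 := by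
  have hL : ∀ p ∈ HasAntidiagonal.antidiagonal n, (-1 : MvPowerSeries ℕ ℤ) ^ p.1 *
      (∑ μ ∈ diagrams M with VerticalStrip l μ ∧ μ.card = l.card + p.1, schur μ) * h p.2 =
      ∑ μ ∈ diagrams M with VerticalStrip l μ ∧ μ.card = l.card + p.1,
        ∑ κ ∈ diagrams M with HorizontalStrip μ κ ∧ κ.card = μ.card + p.2,
          (-1) ^ p.1 * schur κ := by
    intro p hp
    rw [HasAntidiagonal.mem_antidiagonal] at hp
    rw [mul_sum, sum_mul]
    refine sum_congr rfl fun μ hμ => ?_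
    have := (mem_filter.1 hμ).2.2
    rw [mul_assoc, mul_comm (schur μ), h_mul_schur μ p.2 (M := M) (by omega), mul_sum]
  have hR : ∑ κ ∈ diagrams M with κ.card = l.card + n,
      ∑ μ ∈ diagrams M with VerticalStrip l μ ∧ HorizontalStrip μ κ,
        (-1 : MvPowerSeries ℕ ℤ) ^ (μ.card - l.card) * schur κ = 0 := by
    refine sum_eq_zero fun κ hκ => ?_
    rw [mem_filter, mem_diagrams] at hκ
    have hz := congrArg (Int.castRingHom (MvPowerSeries ℕ ℤ))
      (sum_sign_eq_zero (l := l) (κ := κ) (by rintro rfl; omega) hκ.1)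
    have hs : ∀ μ ∈ {μ ∈ diagrams M | VerticalStrip l μ ∧ HorizontalStrip μ κ},
        (-1 : MvPowerSeries ℕ ℤ) ^ (μ.card - l.card) = (-1) ^ l.card * (-1) ^ μ.card := by
      intro μ hμ
      obtain ⟨c, hc⟩ := Nat.exists_eq_add_of_le (card_mono (mem_filter.1 hμ).2.1.le)
      rw [hc, Nat.add_sub_cancel_left, pow_add, ← mul_assoc, ← mul_pow]
      simp
    rw [map_sum] at hz
    simp only [map_pow, map_neg, map_one, map_zero] at hz
    rw [← sum_mul, sum_congr rfl hs, ← mul_sum, hz, mul_zero, zero_mul]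
  rw [sum_congr rfl hL, ← hR]
  simp only [sum_sigma']
  refine sum_bij' (fun a _ => ⟨a.2.2, a.2.1⟩)
    (fun b _ => ⟨(b.2.card - l.card, b.1.card - b.2.card), b.2, b.1⟩) ?_ ?_ ?_ ?_ ?_
  · rintro ⟨⟨a, b⟩, μ, κ⟩ ha
    simp only [mem_sigma, HasAntidiagonal.mem_antidiagonal, mem_filter, mem_diagrams] at ha ⊢
    obtain ⟨hab, ⟨hμM, h1, h2⟩, hκM, h3, h4⟩ := ha
    exact ⟨⟨hκM, by omega⟩, hμM, h1, h3⟩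
  · rintro ⟨κ, μ⟩ hb
    simp only [mem_sigma, HasAntidiagonal.mem_antidiagonal, mem_filter, mem_diagrams] at hb ⊢
    obtain ⟨⟨hκM, h1⟩, hμM, h2, h3⟩ := hb
    have := card_mono h2.le
    have := card_mono h3.le
    exact ⟨by omega, ⟨hμM, h2, by omega⟩, hκM, h3, by omega⟩
  · rintro ⟨⟨a, b⟩, μ, κ⟩ ha
    simp only [mem_sigma, HasAntidiagonal.mem_antidiagonal, mem_filter, mem_diagrams] at ha ⊢
    obtain ⟨hab, ⟨hμM, h1, h2⟩, hκM, h3, h4⟩ := ha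
    rw [show μ.card - l.card = a by omega, show κ.card - μ.card = b by omega]
  · rintro ⟨κ, μ⟩ hb
    rfl
  · rintro ⟨⟨a, b⟩, μ, κ⟩ ha
    simp only [mem_sigma, HasAntidiagonal.mem_antidiagonal, mem_filter, mem_diagrams] at ha ⊢
    obtain ⟨hab, ⟨hμM, h1, h2⟩, hκM, h3, h4⟩ := ha
    rw [show μ.card - l.card = a by omega]

open Classical in
/-- **Pieri's rule** for elementary symmetric functions. -/
theorem e_mul_schur (l : YoungDiagram) (n : ℕ) : ∀ {M : ℕ}, l.card + n ≤ M →
    e n * schur l =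
      ∑ κ ∈ diagrams M with VerticalStrip l κ ∧ κ.card = l.card + n, schur κ := by
  induction n using Nat.strong_induction_on with
  | _ n ih =>
    intro M hM
    rcases eq_or_ne n 0 with rfl | hn
    · rw [e_zero, one_mul, sum_eq_single l]
      · intro κ hκ hne
        have hκ := (mem_filter.1 hκ).2
        exact absurd (eq_of_le_of_card_le hκ.1.le (by omega)).symm hne
      · intro hl
        refine absurd (mem_filter.2 ⟨mem_diagrams.2 (by omega), fun i => ?_, by omega⟩) hl
        omega
    · have h1 := congrArg (· * schur l) (sum_e_mul_h n hn)
      simp only [zero_mul] at h1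
      have h2 := sum_vertical_mul_h l hn hM
      -- The two recursions are subtracted: by induction all terms with `p.1 < n` agree, which
      -- leaves the term `(n, 0)`, where `h 0 = 1`.
      rw [← h2, sum_mul, ← sub_eq_zero, ← sum_sub_distrib, sum_eq_single (n, 0)] at h1
      · have hu : IsUnit ((-1 : MvPowerSeries ℕ ℤ) ^ n) := (isUnit_one.neg).pow n
        simp only [h_zero, mul_one] at h1
        rw [mul_assoc, ← mul_sub, hu.mul_right_eq_zero, sub_eq_zero] at h1
        exact h1
      · rintro ⟨a, b⟩ hp hne
        rw [HasAntidiagonal.mem_antidiagonal] at hp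
        simp only at hp ⊢
        have ha : a < n := by
          by_contra! hc
          exact hne (Prod.ext (by simp only; omega) (by simp only; omega))
        rw [← ih a ha (M := M) (by omega)]
        ring
      · intro hmem
        exact absurd (by simp) hmem

end DualPieri

/-! ### Linear independence, by triangularity in the dominance order. -/

section LinearIndependence

theorem le_entry {l : YoungDiagram} (T : SemistandardYoungTableau l) {i j : ℕ}
    (hij : (i, j) ∈ l) : i ≤ T i j := by
  induction i with
  | zero => exact Nat.zero_le _
  | succ i ih =>
    have h1 := ih (l.up_left_mem (Nat.le_succ i) le_rfl hij)
    have h2 := T.col_strict (Nat.lt_add_one i) hij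
    omega

/-- The number of cells in the first `k` rows. -/
def rowSum (l : YoungDiagram) (k : ℕ) : ℕ := #{c ∈ l.cells | c.1 < k}

theorem rowSum_succ (l : YoungDiagram) (k : ℕ) : rowSum l (k + 1) = rowSum l k + l.rowLen k := by
  rw [YoungDiagram.rowLen_eq_card, YoungDiagram.row, rowSum, rowSum,
    ← card_union_of_disjoint, ← filter_or]
  · congr 1
    exact filter_congr fun c _ => by omega
  · rw [disjoint_filter]
    intro c _ hc
    omega

theorem rowSum_injective : Function.Injective rowSum := by
  intro l μ hl
  refine ext_rowLen fun i => ?_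
  have h1 := congrFun hl i
  have h2 := congrFun hl (i + 1)
  rw [rowSum_succ, rowSum_succ] at h2
  omega

theorem sum_content {l : YoungDiagram} (T : SemistandardYoungTableau l) (k : ℕ) :
    ∑ i ∈ range k, content T i = #{c ∈ l.cells | T c.1 c.2 < k} := by
  have hmap : ∀ c ∈ {c ∈ l.cells | T c.1 c.2 < k}, T c.1 c.2 ∈ range k := fun c hc =>
    mem_range.2 (mem_filter.1 hc).2
  rw [card_eq_sum_card_fiberwise hmap]
  refine sum_congr rfl fun i hi => ?_
  rw [content_apply, filter_filter]
  congr 1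
  refine filter_congr fun c _ => ?_
  have := mem_range.1 hi
  omega

/-- The content of a tableau is dominated by its shape. -/
theorem rowSum_le_of_content_eq {l μ : YoungDiagram} (T : SemistandardYoungTableau l)
    (hT : content T = content (SemistandardYoungTableau.highestWeight μ)) :
    rowSum μ ≤ rowSum l := by
  intro k
  have h1 : rowSum μ k =
      ∑ i ∈ range k, content (SemistandardYoungTableau.highestWeight μ) i := by
    rw [sum_content, rowSum]
    congr 1
    refine filter_congr fun c hc => ?_
    rw [SemistandardYoungTableau.highestWeight_apply, if_pos ((YoungDiagram.mem_cells _).1 hc)]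
  rw [h1, ← hT, sum_content, rowSum]
  -- Strict columns force an entry to be at least its row index, so entries below `k` lie in the
  -- first `k` rows.
  refine card_le_card fun c hc => ?_
  rw [mem_filter] at hc ⊢
  exact ⟨hc.1, (le_entry T hc.1).trans_lt hc.2⟩

/-- In a relation, choose a diagram `μ` of the support that is maximal for dominance. The monomial
of its highest weight tableau occurs in `s_μ` but in no other `s_l` of the relation, since such an
`l` would dominate `μ`. -/
theorem linearIndependent_schur : LinearIndependent ℤ schur := by
  rw [linearIndependent_iff]
  intro c hc
  by_contra hne
  obtain ⟨μ, hμ, hmax⟩ :=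
    exists_maximalFor rowSum c.support (Finsupp.support_nonempty_iff.2 hne)
  set d := content (SemistandardYoungTableau.highestWeight μ) with hd
  have hcoeff := congrArg (MvPowerSeries.coeff d) hc
  rw [Finsupp.linearCombination_apply, Finsupp.sum, map_sum, map_zero, sum_eq_single μ] at hcoeff
  · rw [map_zsmul, smul_eq_mul, mul_eq_zero, coeff_schur, Nat.cast_eq_zero] at hcoeff
    rcases hcoeff with h0 | h0
    · exact Finsupp.mem_support_iff.1 hμ h0
    · have : Finite {T : SemistandardYoungTableau μ // content T = d} := finite_content d
      have : Nonempty {T : SemistandardYoungTableau μ // content T = d} := ⟨⟨_, rfl⟩⟩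
      exact Nat.card_pos.ne' h0
  · intro l hl hlμ
    have : IsEmpty {T : SemistandardYoungTableau l // content T = d} := by
      refine ⟨fun T => hlμ ?_⟩
      have hle := rowSum_le_of_content_eq T.1 (T.2.trans hd)
      exact rowSum_injective (le_antisymm (hmax hl hle) hle)
    rw [map_zsmul, coeff_schur, Nat.card_of_isEmpty, Nat.cast_zero, smul_zero]
  · exact fun hn => absurd hμ hn

end LinearIndependence

/-! ### Removing the first column or the first row. -/

section Peeling

/-- Here `ρ` is `π` without its first column. Among the vertical strips of size `π.colLen 0` on `ρ`,
only the one giving back `π` creates no row beyond those of `π`. -/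
theorem exists_e_mul_schur_eq (π : YoungDiagram) : ∃ (ρ : YoungDiagram) (S : Finset YoungDiagram),
    ρ.card + π.colLen 0 = π.card ∧
    e (π.colLen 0) * schur ρ = schur π + ∑ κ ∈ S, schur κ ∧
    ∀ κ ∈ S, κ.card = π.card ∧ π.colLen 0 < κ.colLen 0 := by
  classical
  set k := π.colLen 0
  have hk : π.rowLen k = 0 := rowLen_eq_zero_iff.2 le_rfl
  have hpos : ∀ i, i < k → 0 < π.rowLen i := fun i hi => by
    have := mt (rowLen_eq_zero_iff (l := π) (i := i)).1 (not_le.2 hi)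
    omega
  have hρ : ∀ i, (ofRows fun i => π.rowLen i - 1).rowLen i = π.rowLen i - 1 :=
    rowLen_ofRows (fun i j hij => Nat.sub_le_sub_right (π.rowLen_anti i j hij) 1) (M := k)
      (by omega)
  set ρ := ofRows fun i => π.rowLen i - 1
  have hcard : ρ.card + k = π.card := by
    rw [card_eq_sum_rowLen (l := ρ) (M := k) (by rw [hρ]; omega), card_eq_sum_rowLen hk]
    calc ∑ i ∈ range k, ρ.rowLen i + k = ∑ i ∈ range k, (ρ.rowLen i + 1) := by
          simp [sum_add_distrib]
      _ = ∑ i ∈ range k, π.rowLen i := sum_congr rfl fun i hi => by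
          have := hpos i (mem_range.1 hi)
          rw [hρ]
          omega
  have hπ : π ∈ {κ ∈ diagrams π.card | VerticalStrip ρ κ ∧ κ.card = ρ.card + k} := by
    refine mem_filter.2 ⟨mem_diagrams.2 le_rfl, fun i => ?_, hcard.symm⟩
    rw [hρ]
    omega
  refine ⟨ρ, {κ ∈ diagrams π.card | VerticalStrip ρ κ ∧ κ.card = ρ.card + k}.erase π, hcard,
    ?_, ?_⟩
  · rw [e_mul_schur ρ k hcard.le, ← add_sum_erase _ _ hπ]
  · intro κ hκ
    rw [mem_erase, mem_filter] at hκ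
    obtain ⟨hne, -, hs, hc⟩ := hκ
    refine ⟨hc.trans hcard, ?_⟩
    -- If `κ` has at most `k` rows, then `κ_i ≤ ρ_i + 1 = π_i` for `i < k`; so `κ ⊆ π`, and equal
    -- sizes give `κ = π`.
    by_contra! hle
    refine hne (eq_of_le_of_card_le (le_iff_rowLen.2 fun i => ?_) (by omega))
    by_cases hi : i < k
    · have h1 := (hs i).2
      rw [hρ] at h1
      have := hpos i hi
      omega
    · rw [rowLen_eq_zero_iff.2 (by omega)]
      exact Nat.zero_le _

/-- Here `ρ` is `π` without its first row. A horizontal strip gives `κ_{i+1} ≤ ρ_i = π_{i+1}`, so a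
`κ` of the same size other than `π` must have a longer first row. -/
theorem exists_h_mul_schur_eq (π : YoungDiagram) : ∃ (ρ : YoungDiagram) (S : Finset YoungDiagram),
    h (π.rowLen 0) * schur ρ = schur π + ∑ κ ∈ S, schur κ ∧
    ∀ κ ∈ S, κ.card = π.card ∧ π.rowLen 0 < κ.rowLen 0 := by
  classical
  set k := π.rowLen 0
  have hρ : ∀ i, (ofRows fun i => π.rowLen (i + 1)).rowLen i = π.rowLen (i + 1) :=
    rowLen_ofRows (fun i j hij => π.rowLen_anti _ _ (Nat.succ_le_succ hij)) (M := π.card)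
      (rowLen_of_card_le π (Nat.le_succ _))
  set ρ := ofRows fun i => π.rowLen (i + 1)
  have hcard : ρ.card + k = π.card := by
    have h0 : π.rowLen (π.card + 1) = 0 := rowLen_of_card_le π (Nat.le_succ π.card)
    have h1 := card_eq_sum_rowLen h0
    have h2 := card_eq_sum_rowLen (l := ρ) (M := π.card) (by rw [hρ]; exact h0)
    rw [sum_range_succ'] at h1
    simp only [hρ] at h2
    rw [h2]
    exact h1.symm
  have hπ : π ∈ {κ ∈ diagrams π.card | HorizontalStrip ρ κ ∧ κ.card = ρ.card + k} := by
    refine mem_filter.2 ⟨mem_diagrams.2 le_rfl, fun i => ?_, hcard.symm⟩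
    rw [hρ]
    exact ⟨le_rfl, π.rowLen_anti _ _ (Nat.le_succ i)⟩
  refine ⟨ρ, {κ ∈ diagrams π.card | HorizontalStrip ρ κ ∧ κ.card = ρ.card + k}.erase π, ?_, ?_⟩
  · rw [h_mul_schur ρ k hcard.le, ← add_sum_erase _ _ hπ]
  · intro κ hκ
    rw [mem_erase, mem_filter] at hκ
    obtain ⟨hne, -, hs, hc⟩ := hκ
    refine ⟨hc.trans hcard, ?_⟩
    by_contra! hle
    refine hne (eq_of_le_of_card_le (le_iff_rowLen.2 fun i => ?_) (by omega))
    cases i with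
    | zero => exact hle
    | succ i =>
      have h1 := (hs i).1
      rwa [hρ] at h1

/-- Double induction: peeling reduces `s_π` to a smaller diagram and to diagrams of the same size
with more rows, whose number is bounded by the size. -/
theorem schur_mem (π : YoungDiagram) : schur π ∈ Lam := by
  suffices ∀ (c b : ℕ) (π : YoungDiagram), π.card = c → c - π.colLen 0 = b → schur π ∈ Lam from
    this _ _ π rfl rfl
  intro c
  induction c using Nat.strong_induction_on with
  | _ c ihc =>
    intro b
    induction b using Nat.strong_induction_on with
    | _ b ihb =>
      intro π hc hb
      rcases eq_or_ne π ⊥ with rfl | hπ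
      · rw [schur_bot]
        exact Lam.one_mem
      · obtain ⟨ρ, S, h1, h2, h3⟩ := exists_e_mul_schur_eq π
        have hpos : π.colLen 0 ≠ 0 := by
          intro h0
          refine hπ (eq_of_le_of_card_le bot_le ?_).symm
          rw [card_eq_sum_rowLen (M := 0) (rowLen_eq_zero_iff.2 h0.le)]
          simp
        rw [← sub_eq_iff_eq_add] at h2
        rw [← h2]
        refine Lam.sub_mem (Lam.mul_mem (e_mem _) (ihc _ (by omega) _ ρ rfl rfl))
          (Lam.sum_mem fun κ hκ => ?_)
        have h4 := h3 κ hκ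
        have h5 := colLen_le_card κ 0
        exact ihb _ (by omega) κ (by omega) rfl

end Peeling

/-! ### Ideals spanned by Schur functions, and the resulting bases. -/

section Ideals

/-- The Schur function as an element of `Λ`. -/
noncomputable def schurLam (π : YoungDiagram) : Lam := ⟨schur π, schur_mem π⟩

theorem schurLam_bot : schurLam ⊥ = 1 := Subtype.ext schur_bot

theorem linearIndependent_schurLam : LinearIndependent ℤ schurLam :=
  LinearIndependent.of_comp Lam.subtype.toAddMonoidHom.toIntLinearMap linearIndependent_schur

open Classical in
theorem e_mul_schurLam (l : YoungDiagram) (n : ℕ) : (⟨e n, e_mem n⟩ : Lam) * schurLam l =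
    ∑ κ ∈ diagrams (l.card + n) with VerticalStrip l κ ∧ κ.card = l.card + n, schurLam κ := by
  refine Subtype.ext ?_
  rw [Subring.coe_mul, AddSubmonoidClass.coe_finsetSum]
  exact e_mul_schur l n le_rfl

open Classical in
theorem h_mul_schurLam (l : YoungDiagram) (n : ℕ) : (⟨h n, h_mem n⟩ : Lam) * schurLam l =
    ∑ κ ∈ diagrams (l.card + n) with HorizontalStrip l κ ∧ κ.card = l.card + n, schurLam κ := by
  refine Subtype.ext ?_
  rw [Subring.coe_mul, AddSubmonoidClass.coe_finsetSum]
  exact h_mul_schur l n le_rfl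

/-- It suffices to multiply by the generators `e n`, and Pieri's rule only enlarges diagrams. -/
theorem mul_mem_span_schurLam {U : Set YoungDiagram} (hU : IsUpperSet U) (x : Lam) :
    ∀ y ∈ Submodule.span ℤ (schurLam '' U), x * y ∈ Submodule.span ℤ (schurLam '' U) := by
  classical
  obtain ⟨x, hx⟩ := x
  induction hx using Subring.closure_induction with
  | mem x hx =>
    obtain ⟨n, rfl⟩ := hx
    intro y hy
    induction hy using Submodule.span_induction with
    | mem y hy =>
      obtain ⟨l, hl, rfl⟩ := hy
      rw [e_mul_schurLam]
      refine Submodule.sum_mem _ fun κ hκ => Submodule.subset_span ⟨κ, ?_, rfl⟩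
      exact hU (mem_filter.1 hκ).2.1.le hl
    | zero => rw [mul_zero]; exact Submodule.zero_mem _
    | add y z _ _ h1 h2 => rw [mul_add]; exact Submodule.add_mem _ h1 h2
    | smul a y _ h1 => rw [mul_smul_comm]; exact Submodule.smul_mem _ a h1
  | zero =>
    intro y _
    exact (zero_mul y).symm ▸ Submodule.zero_mem _
  | one =>
    intro y hy
    exact (one_mul y).symm ▸ hy
  | add a b ha hb h1 h2 =>
    intro y hy
    exact (add_mul (⟨a, ha⟩ : Lam) ⟨b, hb⟩ y).symm ▸ Submodule.add_mem _ (h1 y hy) (h2 y hy)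
  | neg a ha h1 =>
    intro y hy
    exact (neg_mul (⟨a, ha⟩ : Lam) y).symm ▸ Submodule.neg_mem _ (h1 y hy)
  | mul a b ha hb h1 h2 =>
    intro y hy
    exact (mul_assoc (⟨a, ha⟩ : Lam) ⟨b, hb⟩ y).symm ▸ h1 _ (h2 y hy)

theorem mem_ideal_iff_mem_span {U : Set YoungDiagram} (hU : IsUpperSet U) {G : Set Lam}
    (hG : ∀ x ∈ G, x ∈ Submodule.span ℤ (schurLam '' U))
    (hs : ∀ π ∈ U, schurLam π ∈ Ideal.span G) (x : Lam) :
    x ∈ Ideal.span G ↔ x ∈ Submodule.span ℤ (schurLam '' U) := by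
  constructor
  · intro hx
    induction hx using Submodule.span_induction with
    | mem y hy => exact hG y hy
    | zero => exact Submodule.zero_mem _
    | add y z _ _ h1 h2 => exact Submodule.add_mem _ h1 h2
    | smul a y _ h1 => exact mul_mem_span_schurLam hU a y h1
  · intro hx
    induction hx using Submodule.span_induction with
    | mem y hy => obtain ⟨π, hπ, rfl⟩ := hy; exact hs π hπ
    | zero => exact Ideal.zero_mem _
    | add y z _ _ h1 h2 => exact Ideal.add_mem _ h1 h2
    | smul a y _ h1 => rw [zsmul_eq_mul]; exact Ideal.mul_mem_left _ _ h1

/-- Common argument for `e` and `h`, with `f` the number of rows or the length of the first row. The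
induction on `π.card - f π` terminates because the correction terms keep the size and increase `f`.
-/
theorem schurLam_mem_ideal {I : Ideal Lam} {f : YoungDiagram → ℕ} {g : ℕ → Lam} {n : ℕ}
    (hf : ∀ π, f π ≤ π.card) (hg : ∀ k, n ≤ k → g k ∈ I)
    (hp : ∀ π, ∃ (ρ : YoungDiagram) (S : Finset YoungDiagram),
      g (f π) * schurLam ρ = schurLam π + ∑ κ ∈ S, schurLam κ ∧
      ∀ κ ∈ S, κ.card = π.card ∧ f π < f κ) (π : YoungDiagram) (hπ : n ≤ f π) :
    schurLam π ∈ I := by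
  obtain ⟨b, hb⟩ : ∃ b, π.card - f π = b := ⟨_, rfl⟩
  induction b using Nat.strong_induction_on generalizing π with
  | _ b ih =>
    obtain ⟨ρ, S, h1, h2⟩ := hp π
    rw [← sub_eq_iff_eq_add] at h1
    rw [← h1]
    refine I.sub_mem (I.mul_mem_right _ (hg _ hπ)) (I.sum_mem fun κ hκ => ?_)
    have h3 := h2 κ hκ
    have h4 := hf κ
    exact ih _ (by omega) κ (by omega) rfl

theorem isUpperSet_le_colLen (n : ℕ) : IsUpperSet {π : YoungDiagram | n ≤ π.colLen 0} := by
  intro μ l hle hμ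
  have h1 : μ.colLen 0 ≤ l.colLen 0 := by
    rw [← YoungDiagram.rowLen_transpose, ← YoungDiagram.rowLen_transpose]
    exact le_iff_rowLen.1 (YoungDiagram.transpose_mono hle) 0
  exact le_trans hμ h1

theorem isUpperSet_le_rowLen (n : ℕ) : IsUpperSet {π : YoungDiagram | n ≤ π.rowLen 0} :=
  fun _ _ hle hμ => le_trans hμ (le_iff_rowLen.1 hle 0)

theorem mem_Ie_iff (n : ℕ) (x : Lam) : x ∈ Ie n ↔
    x ∈ Submodule.span ℤ (schurLam '' {π : YoungDiagram | n ≤ π.colLen 0}) := by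
  classical
  refine mem_ideal_iff_mem_span (isUpperSet_le_colLen n) ?_ ?_ x
  · rintro _ ⟨i, hi, rfl⟩
    rw [← mul_one (⟨e i, _⟩ : Lam), ← schurLam_bot, e_mul_schurLam]
    refine Submodule.sum_mem _ fun κ hκ => Submodule.subset_span ⟨κ, hi.trans ?_, rfl⟩
    obtain ⟨h1, h2⟩ := (mem_filter.1 hκ).2
    rw [card_bot, zero_add, card_eq_sum_rowLen (l := κ) (rowLen_eq_zero_iff.2 le_rfl)] at h2
    rw [← h2]
    -- A vertical strip on the empty diagram has rows of length at most one, so its size `i` is at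
    -- most its number of rows.
    refine (sum_le_card_nsmul _ _ 1 fun j _ => ?_).trans (by simp)
    have := (h1 j).2
    rwa [rowLen_bot] at this
  · refine fun π hπ => schurLam_mem_ideal (I := Ie n) (f := fun π => π.colLen 0)
      (g := fun i => ⟨e i, e_mem i⟩) (fun π => colLen_le_card π 0)
      (fun k hk => Ideal.subset_span ⟨k, hk, rfl⟩) (fun π => ?_) π hπ
    obtain ⟨ρ, S, -, h1, h2⟩ := exists_e_mul_schur_eq π
    refine ⟨ρ, S, Subtype.ext ?_, h2⟩
    rw [Subring.coe_add, AddSubmonoidClass.coe_finsetSum]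
    exact h1

theorem mem_Ih_iff (n : ℕ) (x : Lam) : x ∈ Ih n ↔
    x ∈ Submodule.span ℤ (schurLam '' {π : YoungDiagram | n ≤ π.rowLen 0}) := by
  classical
  refine mem_ideal_iff_mem_span (isUpperSet_le_rowLen n) ?_ ?_ x
  · rintro _ ⟨i, hi, rfl⟩
    rw [← mul_one (⟨h i, _⟩ : Lam), ← schurLam_bot, h_mul_schurLam]
    refine Submodule.sum_mem _ fun κ hκ => Submodule.subset_span ⟨κ, hi.trans ?_, rfl⟩
    obtain ⟨h1, h2⟩ := (mem_filter.1 hκ).2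
    -- A horizontal strip on the empty diagram is a single row.
    have h3 : κ.rowLen 1 ≤ (⊥ : YoungDiagram).rowLen 0 := (h1 0).1
    rw [rowLen_bot] at h3
    rw [card_bot, zero_add, card_eq_sum_rowLen (l := κ) (M := 1) (by omega)] at h2
    simpa using h2.ge
  · refine fun π hπ => schurLam_mem_ideal (I := Ih n) (f := fun π => π.rowLen 0)
      (g := fun i => ⟨h i, h_mem i⟩) (fun π => rowLen_le_card π 0)
      (fun k hk => Ideal.subset_span ⟨k, hk, rfl⟩) (fun π => ?_) π hπ
    obtain ⟨ρ, S, h1, h2⟩ := exists_h_mul_schur_eq π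
    refine ⟨ρ, S, Subtype.ext ?_, h2⟩
    rw [Subring.coe_add, AddSubmonoidClass.coe_finsetSum]
    exact h1

/-- The Schur functions form a basis of `Λ`. -/
noncomputable def schurBasis : Module.Basis YoungDiagram ℤ Lam :=
  Module.Basis.mk linearIndependent_schurLam fun x _ => by
    have h1 : (1 : Lam) ∈ Submodule.span ℤ (schurLam '' Set.univ) :=
      schurLam_bot ▸ Submodule.subset_span ⟨⊥, trivial, rfl⟩
    have h2 := mul_mem_span_schurLam isUpperSet_univ x 1 h1
    rwa [mul_one, Set.image_univ] at h2

theorem coe_schurBasis : ⇑schurBasis = schurLam := Module.Basis.coe_mk _ _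

theorem mem_span_schurLam_iff {U : Set YoungDiagram} {x : Lam} :
    x ∈ Submodule.span ℤ (schurLam '' U) ↔ ↑(schurBasis.repr x).support ⊆ U := by
  rw [← coe_schurBasis, Module.Basis.mem_span_image]

theorem exists_basis_ideal {U : YoungDiagram → Prop} {I : Ideal Lam}
    (hI : ∀ x, x ∈ I ↔ x ∈ Submodule.span ℤ (schurLam '' {π | U π})) :
    ∃ b : Module.Basis {π // U π} ℤ I, ∀ π, (b π : Lam) = schurLam π := by
  have hmem : ∀ π : {π // U π}, schurLam π ∈ I := fun π =>
    (hI _).2 (Submodule.subset_span ⟨π, π.2, rfl⟩)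
  let v : {π // U π} → I := fun π => ⟨schurLam π, hmem π⟩
  let incl : I →ₗ[ℤ] Lam := (I.subtype : I →ₗ[Lam] Lam).toAddMonoidHom.toIntLinearMap
  have hinj : Function.Injective incl := Subtype.val_injective
  have hv : incl ∘ v = schurLam ∘ Subtype.val := rfl
  have hli : LinearIndependent ℤ v := LinearIndependent.of_comp incl
    (hv ▸ linearIndependent_schurLam.comp _ Subtype.val_injective)
  have hsp : ⊤ ≤ Submodule.span ℤ (Set.range v) := by
    intro x _
    have hx := (hI x).1 x.2
    have hr : schurLam '' {π | U π} = incl '' Set.range v := by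
      rw [← Set.range_comp, hv, Set.range_comp, Subtype.range_coe_subtype]
    rw [hr, Submodule.span_image] at hx
    obtain ⟨y, hy, hyx⟩ := hx
    rwa [← hinj hyx]
  exact ⟨Module.Basis.mk hli hsp, fun π => by rw [Module.Basis.mk_apply]⟩

/-- The ideal is spanned by the complementary part of the Schur basis, so the part indexed by `U`
meets it trivially and generates the quotient. -/
theorem exists_basis_quotient {U : YoungDiagram → Prop} {I : Ideal Lam}
    (hI : ∀ x, x ∈ I ↔ x ∈ Submodule.span ℤ (schurLam '' {π | ¬ U π})) :
    ∃ b : Module.Basis {π // U π} ℤ (Lam ⧸ I),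
      ∀ π, b π = Ideal.Quotient.mk I (schurLam π) := by
  classical
  let q : Lam →ₗ[ℤ] Lam ⧸ I := (Ideal.Quotient.mk I).toAddMonoidHom.toIntLinearMap
  have hq : ∀ x, q x = Ideal.Quotient.mk I x := fun _ => rfl
  let v : {π // U π} → Lam ⧸ I := q ∘ schurLam ∘ Subtype.val
  have hli : LinearIndependent ℤ v := by
    refine (linearIndependent_schurLam.comp _ Subtype.val_injective).map ?_
    rw [Submodule.disjoint_def]
    intro x hx hxq
    rw [LinearMap.mem_ker, hq, Ideal.Quotient.eq_zero_iff_mem, hI, mem_span_schurLam_iff] at hxq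
    rw [Set.range_comp, Subtype.range_coe_subtype, mem_span_schurLam_iff] at hx
    have : (schurBasis.repr x).support = ∅ :=
      eq_empty_of_forall_notMem fun π hπ => hxq hπ (hx hπ)
    simpa using this
  have hsp : ⊤ ≤ Submodule.span ℤ (Set.range v) := by
    intro y _
    obtain ⟨x, rfl⟩ := Ideal.Quotient.mk_surjective y
    have hx : x ∈ Submodule.span ℤ (Set.range schurLam) := by
      rw [← Set.image_univ, mem_span_schurLam_iff]
      exact Set.subset_univ _
    induction hx using Submodule.span_induction with
    | mem x hx =>
      obtain ⟨π, rfl⟩ := hx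
      by_cases hπ : U π
      · exact Submodule.subset_span ⟨⟨π, hπ⟩, rfl⟩
      · rw [Ideal.Quotient.eq_zero_iff_mem.2 ((hI _).2 (Submodule.subset_span ⟨π, hπ, rfl⟩))]
        exact Submodule.zero_mem _
    | zero => rw [map_zero]; exact Submodule.zero_mem _
    | add a b _ _ h1 h2 =>
      rw [map_add]
      exact Submodule.add_mem _ (h1 trivial) (h2 trivial)
    | smul c a _ h1 =>
      rw [map_zsmul]
      exact Submodule.smul_mem _ c (h1 trivial)
  exact ⟨Module.Basis.mk hli hsp, fun π => by rw [Module.Basis.mk_apply]; rfl⟩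

theorem hook_le_iff {m n : ℕ} (hm : 1 ≤ m) (hn : 1 ≤ n) {π : YoungDiagram} :
    hook m n ≤ π ↔ m ≤ π.rowLen 0 ∧ n ≤ π.colLen 0 := by
  constructor
  · intro hle
    have h1 : (0, m - 1) ∈ π := hle (by
      change _ ∈ (hook m n).cells
      simp [hook]
      omega)
    have h2 : (n - 1, 0) ∈ π := hle (by
      change _ ∈ (hook m n).cells
      simp [hook]
      omega)
    rw [YoungDiagram.mem_iff_lt_rowLen] at h1
    rw [YoungDiagram.mem_iff_lt_colLen] at h2
    omega
  · rintro ⟨h1, h2⟩ ⟨i, j⟩ hij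
    change _ ∈ (hook m n).cells at hij
    simp only [hook, mem_union, mem_product, mem_singleton, mem_range] at hij
    rcases hij with ⟨rfl, hj⟩ | ⟨hi, rfl⟩
    · exact YoungDiagram.mem_iff_lt_rowLen.2 (by omega)
    · exact YoungDiagram.mem_iff_lt_colLen.2 (by omega)

end Ideals

/-! ### The quotient `Λ_n` as a polynomial ring. -/

section Truncation

/-- This identifies the truncated series with elementary symmetric polynomials in `n` variables, to
which the fundamental theorem applies. -/
theorem trunc_e (n i : ℕ) : trunc n (e i) =
    ((MvPolynomial.rename Fin.val (MvPolynomial.esymm (Fin n) ℤ i) : MvPolynomial ℕ ℤ) :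
      MvPowerSeries ℕ ℤ) := by
  classical
  ext d
  have hσ : ∀ (t : Finset (Fin n)) (k : ℕ),
      (Finsupp.mapDomain Fin.val (∑ j ∈ t, Finsupp.single j 1) : ℕ →₀ ℕ) k =
        if k ∈ t.map Fin.valEmbedding then 1 else 0 := by
    intro t k
    rw [Finsupp.mapDomain_finsetSum, Finsupp.finsetSum_apply]
    simp only [Finsupp.mapDomain_single, Finsupp.single_apply]
    exact (sum_map t Fin.valEmbedding fun j => if j = k then 1 else 0).symm.trans
      (sum_ite_eq' _ _ _)
  have hdeg : ∀ t : Finset (Fin n),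
      (Finsupp.mapDomain Fin.val (∑ j ∈ t, Finsupp.single j 1) : ℕ →₀ ℕ).degree = #t := by
    intro t
    simp [Finsupp.mapDomain_finsetSum, Finsupp.mapDomain_single]
  rw [coeff_trunc, coeff_e, MvPolynomial.coeff_coe, MvPolynomial.esymm_eq_sum_monomial, map_sum,
    MvPolynomial.coeff_sum]
  simp only [MvPolynomial.rename_monomial, MvPolynomial.coeff_monomial]
  by_cases hd : VarsBelow n d ∧ d.degree = i ∧ ∀ k, d k ≤ 1
  · obtain ⟨h1, h2, h3⟩ := hd
    -- A squarefree exponent in the first `n` variables comes from exactly one subset, namely its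
    -- support.
    have ht : Finsupp.mapDomain Fin.val
        (∑ j ∈ univ.filter (fun j : Fin n => d j = 1), Finsupp.single j 1) = d := by
      ext k
      rw [hσ]
      have h4 := h3 k
      have h5 := h1 k
      by_cases hk : k < n
      · simp [Fin.exists_iff, hk]
        split_ifs <;> omega
      · simp [Fin.exists_iff, hk]
        omega
    rw [if_pos h1, if_pos ⟨h2, h3⟩, sum_eq_single (univ.filter fun j : Fin n => d j = 1), if_pos ht]
    · intro t _ hne
      rw [if_neg]
      intro htd
      apply hne
      ext j
      have := hσ t j
      rw [htd] at this
      simp [this, Fin.val_inj]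
    · intro hn
      refine absurd (mem_powersetCard.2 ⟨subset_univ _, ?_⟩) hn
      rw [← hdeg, ht, h2]
  · rw [sum_eq_zero]
    · split_ifs <;> simp_all
    · intro t ht
      rw [if_neg]
      rintro rfl
      refine hd ⟨fun k hk => ?_, ?_, fun k => ?_⟩
      · rw [hσ, if_neg]
        simp [Fin.exists_iff]
        omega
      · rw [hdeg, (mem_powersetCard.1 ht).2]
      · rw [hσ]
        split_ifs <;> simp

theorem trunc_e_of_lt {n i : ℕ} (hi : n < i) : trunc n (e i) = 0 := by
  rw [trunc_e, MvPolynomial.esymm, powersetCard_eq_empty.2 (by simpa using hi)]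
  simp

/-- The homomorphism `Λ_n → ℤ⟦ξ⟧` that sets the variables `ξ_j` with `j ≥ n` to zero. -/
noncomputable def truncLamN (n : ℕ) : LamN n →+* MvPowerSeries ℕ ℤ :=
  Ideal.Quotient.lift (Ie (n + 1)) ((trunc n).comp Lam.subtype) fun x hx => by
    have hle : Ie (n + 1) ≤ RingHom.ker ((trunc n).comp Lam.subtype) := by
      refine Ideal.span_le.2 ?_
      rintro _ ⟨i, hi, rfl⟩
      exact trunc_e_of_lt hi
    exact hle hx

/-- The homomorphism `ℤ[X_1, …, X_n] → Λ_n` that sends `X_i` to the class of `e_i`. -/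
noncomputable def polyToLamN (n : ℕ) : MvPolynomial (Fin n) ℤ →+* LamN n :=
  MvPolynomial.eval₂Hom (Int.castRingHom _) fun i =>
    Ideal.Quotient.mk (Ie (n + 1)) ⟨e (i + 1), e_mem (i + 1)⟩

theorem polyToLamN_X (n : ℕ) (i : Fin n) : polyToLamN n (MvPolynomial.X i) =
    Ideal.Quotient.mk (Ie (n + 1)) ⟨e (i + 1), e_mem (i + 1)⟩ :=
  MvPolynomial.eval₂Hom_X' _ _ _

/-- Followed by truncation to `n` variables, the map sends the variables to the elementary symmetric
polynomials of degrees `1, …, n`, which are algebraically independent. -/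
theorem polyToLamN_injective (n : ℕ) : Function.Injective (polyToLamN n) := by
  have hcomp : (truncLamN n).comp (polyToLamN n) =
      (MvPolynomial.coeToMvPowerSeries.ringHom.comp
        (MvPolynomial.rename (Fin.val : Fin n → ℕ) : _ →ₐ[ℤ] _).toRingHom).comp
        ((MvPolynomial.symmetricSubalgebra (Fin n) ℤ).val.comp
          (MvPolynomial.esymmAlgHom (Fin n) ℤ n)).toRingHom := by
    refine MvPolynomial.ringHom_ext' (RingHom.ext_int _ _) fun i => ?_
    rw [RingHom.comp_apply, polyToLamN_X]
    change trunc n (e (i + 1)) = _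
    rw [trunc_e]
    simp [MvPolynomial.esymmAlgHom_apply]
  have hinj : Function.Injective ((truncLamN n).comp (polyToLamN n)) := by
    rw [hcomp]
    exact ((MvPolynomial.coe_injective _ _).comp
      (MvPolynomial.rename_injective _ Fin.val_injective)).comp
      (Subtype.val_injective.comp (MvPolynomial.esymmAlgHom_fin_injective ℤ le_rfl))
  exact Function.Injective.of_comp hinj

theorem polyToLamN_surjective (n : ℕ) : Function.Surjective (polyToLamN n) := by
  intro y
  obtain ⟨⟨x, hx⟩, rfl⟩ := Ideal.Quotient.mk_surjective y
  rw [← RingHom.mem_range]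
  induction hx using Subring.closure_induction with
  | mem x hx =>
    obtain ⟨i, rfl⟩ := hx
    rcases Nat.eq_zero_or_pos i with rfl | hi
    · have : (⟨e 0, e_mem 0⟩ : Lam) = 1 := Subtype.ext e_zero
      exact this.symm ▸ (map_one (Ideal.Quotient.mk (Ie (n + 1)))).symm ▸ one_mem _
    · obtain ⟨i, rfl⟩ : ∃ j, i = j + 1 := ⟨i - 1, by omega⟩
      by_cases hin : i < n
      · exact ⟨_, polyToLamN_X n ⟨i, hin⟩⟩
      · have : Ideal.Quotient.mk (Ie (n + 1)) ⟨e (i + 1), e_mem (i + 1)⟩ = 0 :=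
          Ideal.Quotient.eq_zero_iff_mem.2 (Ideal.subset_span ⟨i + 1, by omega, rfl⟩)
        exact this.symm ▸ zero_mem _
  | zero => exact zero_mem (polyToLamN n).range
  | one => exact one_mem (polyToLamN n).range
  | add a b ha hb h1 h2 => exact add_mem h1 h2
  | neg a ha h1 => exact neg_mem h1
  | mul a b ha hb h1 h2 => exact mul_mem h1 h2

end Truncation

end SymmetricFunctions

theorem mainTheorem8 :
    ∃ hs : ∀ π : YoungDiagram, schur π ∈ Lam,
      (∀ n : ℕ, ∃ b : Module.Basis {π : YoungDiagram // n ≤ π.colLen 0} ℤ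
          (Ie n),
        ∀ π, (b π : Lam) = ⟨schur π, hs π⟩) ∧
      (∀ n : ℕ,
        (∃ φ : LamN n ≃+* MvPolynomial (Fin n) ℤ,
          ∀ i : Fin n, φ (Ideal.Quotient.mk (Ie (n + 1))
            ⟨e (i + 1), e_mem (i + 1)⟩) =
              MvPolynomial.X i) ∧
        ∃ b : Module.Basis {π : YoungDiagram // π.colLen 0 ≤ n} ℤ (LamN n),
          ∀ π, b π = Ideal.Quotient.mk (Ie (n + 1))
            ⟨schur π, hs π⟩) ∧
      (∀ n : ℕ, ∃ b : Module.Basis {π : YoungDiagram // n ≤ π.rowLen 0} ℤ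
          (Ih n),
        ∀ π, (b π : Lam) = ⟨schur π, hs π⟩) ∧
      (∀ m n : ℕ, 1 ≤ m → 1 ≤ n →
        ∃ b : Module.Basis {π : YoungDiagram // hook m n ≤ π} ℤ
            ↥(Ih m ⊓ Ie n),
          ∀ π, (b π : Lam) = ⟨schur π, hs π⟩) := by
  refine ⟨schur_mem, fun n => exists_basis_ideal (mem_Ie_iff n), fun n => ⟨⟨?_, ?_⟩, ?_⟩,
    fun n => exists_basis_ideal (mem_Ih_iff n), fun m n hm hn => exists_basis_ideal fun x => ?_⟩
  · exact (RingEquiv.ofBijective (polyToLamN n)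
      ⟨polyToLamN_injective n, polyToLamN_surjective n⟩).symm
  · intro i
    rw [RingEquiv.symm_apply_eq]
    exact (polyToLamN_X n i).symm
  · refine exists_basis_quotient fun x => ?_
    rw [mem_Ie_iff]
    simp only [not_le, Nat.succ_le_iff]
  -- Both ideals are spanned by parts of one basis, so membership is a condition on the support of
  -- the coordinates, and the intersection is spanned by the common part.
  · rw [Ideal.mem_inf, mem_Ih_iff, mem_Ie_iff, mem_span_schurLam_iff, mem_span_schurLam_iff,
      mem_span_schurLam_iff, ← Set.subset_inter_iff]
    simp only [hook_le_iff hm hn]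
    rfl
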